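/- Let $\alpha,\gamma\ge 0$. For each $N$ let $V^N$ be a set with $|V^N|=N$, let $a^N(u,v)=\frac1{N-1}\mathbf 1_{\{u\ne v\}}$ be the step kernel of the complete graph on $V^N$, and let $$b^N(u,(v,w))=a^N(u,v)\,\frac{a^N(v,w)\mathbf 1_{\{w\neq u\}}}{\sum_{w'\neq u}a^N(v,w')}\ \text{ if } a^N(v,u)<1,\qquad b^N(u,(v,w))=0\ \text{ otherwise}$$ (so $b^N(u,(v,w))=\frac{1}{(N-1)(N-2)}\mathbf 1_{\{u,v,w\text{ distinct}\}}$ for $N\ge 3$). Let $X^N=(X^N_t)_{t\ge0}$ be the cooperative voter model with bias and cooperation (cVMBC) on $V^N$, that is, a càdlàg Markov process on $\{0,1\}^{V^N}$, with arbitrary initial law, whose transition semigroup is $e^{t\Omega^N}$, where $\Omega^N f(X)=\sum_{u} c^N(u,X)\,(f(X^u)-f(X))$, $X^u$ is $X$ with the value at $u$ changed, and $$c^N(u,X)=\sum_{v} a^N(v,u)X(v)+\gamma\sum_{v}X(v)\sum_{w}X(w)\,b^N(w,(v,u))\quad\text{if }X(u)=0,$$ $$c^N(u,X)=(1+\alpha)\sum_{v}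 a^N(v,u)(1-X(v))+\gamma\sum_{v}(1-X(v))\sum_{w}X(w)\,b^N(w,(v,u))\quad\text{if }X(u)=1.$$ Let $S^N_t:=\frac1N\sum_{u\in V^N}X^N_t(u)$ be the frequency of cooperators (type $1$). Suppose that $S^N_0$ converges in distribution, as $N\to\infty$, to a random variable $s_0$ (possibly deterministic; necessarily $s_0\in[0,1]$ almost surely). Then the ordinary differential equation $$dS_t=-\alpha S_t(1-S_t)\,dt,\qquad S_0=s_0,$$ almost surely has a solution on $[0,\infty)$, and $S^N$ converges in distribution, as $N\to\infty$, to its solution $S=(S_t)_{t\ge0}$, as processes with paths in the space $D([0,\infty),\mathbb R)$ of càdlàg paths with the Skorokhod topology. In particular, the limit does not depend on $\gamma$. -/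

import Mathlib

open MeasureTheory ProbabilityTheory Filter Topology Set
open scoped NNReal Uniformity

noncomputable section

/-! ### The Skorokhod space of càdlàg paths -/

/-- Càdlàg paths `[0, ∞) → E`: right-continuous with left limits. -/
structure CadlagPath (E : Type*) [TopologicalSpace E] where
  toFun : ℝ≥0 → E
  right_cont : ∀ t, ContinuousWithinAt toFun (Ici t) t
  left_lim : ∀ t, ∃ l, Tendsto toFun (𝓝[<] t) (𝓝 l)

namespace CadlagPath

instance instCoeFun {E : Type*} [TopologicalSpace E] :
    CoeFun (CadlagPath E) (fun _ => ℝ≥0 → E) := ⟨CadlagPath.toFun⟩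

/-- The image of a càdlàg path under a continuous map. -/
def map {E F : Type*} [TopologicalSpace E] [TopologicalSpace F] (g : E → F)
    (hg : Continuous g) (x : CadlagPath E) : CadlagPath F where
  toFun t := g (x t)
  right_cont t := hg.continuousAt.comp_continuousWithinAt (x.right_cont t)
  left_lim t := by
    obtain ⟨l, hl⟩ := x.left_lim t
    exact ⟨g l, (hg.tendsto l).comp hl⟩

/-- `(x, y)` belongs to the entourage with parameters `T`, `ε` if for some time change `τ`
(an increasing bijection of `[0, ∞)`), `|τ t - t| ≤ ε` and `dist (x t) (y (τ t)) ≤ ε` for all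
`t ≤ T`. -/
def entourage {E : Type*} [PseudoMetricSpace E] (T : ℝ≥0) (ε : ℝ) :
    Set (CadlagPath E × CadlagPath E) :=
  {p | ∃ τ : ℝ≥0 ≃o ℝ≥0, ∀ t ≤ T, dist (τ t) t ≤ ε ∧ dist (p.1 t) (p.2 (τ t)) ≤ ε}

theorem entourage_mono {E : Type*} [PseudoMetricSpace E] {T T' : ℝ≥0} {ε ε' : ℝ}
    (hT : T' ≤ T) (hε : ε ≤ ε') :
    (entourage T ε : Set (CadlagPath E × CadlagPath E)) ⊆ entourage T' ε' := by
  rintro p ⟨τ, h⟩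
  exact ⟨τ, fun t ht => ⟨(h t (ht.trans hT)).1.trans hε, (h t (ht.trans hT)).2.trans hε⟩⟩

theorem entourage_symm {E : Type*} [PseudoMetricSpace E] (T : ℝ≥0) {ε : ℝ} (hε : ε ≤ 1)
    {x y : CadlagPath E} (h : (x, y) ∈ (entourage (T + 1) ε : Set (CadlagPath E × CadlagPath E))) :
    (y, x) ∈ (entourage T ε : Set (CadlagPath E × CadlagPath E)) := by
  obtain ⟨τ, h⟩ := h
  have key : T ≤ τ (T + 1) := by
    have h1 := (h (T + 1) le_rfl).1
    rw [NNReal.dist_eq, abs_le] at h1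
    have h2 := h1.1
    push_cast at h2
    rw [← NNReal.coe_le_coe]
    linarith
  refine ⟨τ.symm, fun s hs => ?_⟩
  have hs' : τ.symm s ≤ T + 1 := by
    rw [← τ.le_iff_le, τ.apply_symm_apply]
    exact hs.trans key
  have h3 := h _ hs'
  rw [τ.apply_symm_apply] at h3
  exact ⟨by rw [dist_comm]; exact h3.1, by rw [dist_comm]; exact h3.2⟩

theorem entourage_comp {E : Type*} [PseudoMetricSpace E] (T : ℝ≥0) {ε : ℝ} (hε : ε ≤ 1)
    {x y z : CadlagPath E}
    (h : (x, y) ∈ (entourage (T + 1) (ε / 2) : Set (CadlagPath E × CadlagPath E)))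
    (h' : (y, z) ∈ (entourage (T + 1) (ε / 2) : Set (CadlagPath E × CadlagPath E))) :
    (x, z) ∈ (entourage T ε : Set (CadlagPath E × CadlagPath E)) := by
  obtain ⟨τ, h⟩ := h
  obtain ⟨σ, h'⟩ := h'
  refine ⟨τ.trans σ, fun t ht => ?_⟩
  have h1 := h t (ht.trans (by simp))
  have hτ : τ t ≤ T + 1 := by
    have h2 := h1.1
    rw [NNReal.dist_eq, abs_le] at h2
    have ht' : (t : ℝ) ≤ T := NNReal.coe_le_coe.2 ht
    rw [← NNReal.coe_le_coe]
    push_cast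
    linarith
  have h3 := h' (τ t) hτ
  simp only [OrderIso.trans_apply]
  exact ⟨by linarith [dist_triangle (σ (τ t)) (τ t) t, h1.1, h3.1],
    by linarith [dist_triangle (x t) (y (τ t)) (z (σ (τ t))), h1.2, h3.2]⟩

/-- The entourages as a filter basis. -/
def entourageBasis (E : Type*) [PseudoMetricSpace E] :
    FilterBasis (CadlagPath E × CadlagPath E) where
  sets := {U | ∃ T : ℝ≥0, ∃ ε : ℝ, 0 < ε ∧ U = entourage T ε}
  nonempty := ⟨_, 0, 1, one_pos, rfl⟩
  inter_sets := by
    rintro _ _ ⟨T, ε, hε, rfl⟩ ⟨T', ε', hε', rfl⟩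
    exact ⟨_, ⟨max T T', min ε ε', lt_min hε hε', rfl⟩,
      subset_inter (entourage_mono (le_max_left _ _) (min_le_left _ _))
        (entourage_mono (le_max_right _ _) (min_le_right _ _))⟩

/-- The Skorokhod (J1) topology on `D([0, ∞), E)`, as a uniform structure: `xₙ → x` iff for every
`T` there are time changes `τₙ` with `sup_{t ≤ T} |τₙ t - t| → 0` and
`sup_{t ≤ T} dist (x t) (xₙ (τₙ t)) → 0`. -/
instance instUniformSpace {E : Type*} [PseudoMetricSpace E] : UniformSpace (CadlagPath E) :=
  UniformSpace.ofCore <| UniformSpace.Core.mkOfBasis (entourageBasis E)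
    (by
      rintro _ ⟨T, ε, hε, rfl⟩ x
      exact ⟨OrderIso.refl _, fun t _ => by simp [hε.le]⟩)
    (by
      rintro _ ⟨T, ε, hε, rfl⟩
      refine ⟨_, ⟨T + 1, min ε 1, lt_min hε one_pos, rfl⟩, fun p hp => ?_⟩
      exact entourage_mono le_rfl (min_le_left _ _) (entourage_symm T (min_le_right _ _) hp))
    (by
      rintro _ ⟨T, ε, hε, rfl⟩
      refine ⟨_, ⟨T + 1, min ε 1 / 2, half_pos (lt_min hε one_pos), rfl⟩, fun p hp => ?_⟩
      obtain ⟨y, h1, h2⟩ := hp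
      exact entourage_mono le_rfl (min_le_left _ _) (entourage_comp T (min_le_right _ _) h1 h2))

instance instMeasurableSpace {E : Type*} [PseudoMetricSpace E] :
    MeasurableSpace (CadlagPath E) := borel _

instance instBorelSpace {E : Type*} [PseudoMetricSpace E] : BorelSpace (CadlagPath E) := ⟨rfl⟩

end CadlagPath

/-! ### Markov processes on a finite state space -/

/-- The càdlàg process `X` on the probability space `(Ω, P)` is a Markov process on the finite set
`A` with generator `L`, that is, with transition semigroup `exp (t L)`; the initial law is
arbitrary. The conditioning is on the history `σ(X r, r ≤ s)`. -/
structure IsMarkovProcess {Ω : Type*} [MeasurableSpace Ω] (P : Measure Ω)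
    {A : Type*} [Fintype A] [TopologicalSpace A] [MeasurableSpace A]
    (X : Ω → CadlagPath A) (L : (A → ℝ) →L[ℝ] (A → ℝ)) : Prop where
  measurable : ∀ t : ℝ≥0, Measurable (fun ω => X ω t)
  markov : ∀ (s t : ℝ≥0) (f : A → ℝ),
    P[fun ω => f (X ω (s + t)) |
        ⨆ r : Iic s, MeasurableSpace.comap (fun ω => X ω r) inferInstance]
      =ᵐ[P] fun ω => NormedSpace.exp ((t : ℝ) • L) f (X ω s)

/-! ### The voter model with bias and cooperation -/

/-- `1` if there is a cooperator at `u`, `0` if there is a defector. -/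
def occ {V : Type*} (X : V → Bool) (u : V) : ℝ := if X u then 1 else 0

/-- The configuration `X` with the type at `u` changed. -/
def flipAt {V : Type*} [DecidableEq V] (X : V → Bool) (u : V) : V → Bool :=
  Function.update X u (!X u)

/-- The rate at which the type at `u` changes in configuration `X`, for bias `α`, cooperation
parameter `γ`, reproduction kernel `a` and cooperation kernel `b`. -/
def vmbcRate {V : Type*} [Fintype V] (a : V → V → ℝ) (b : V → V × V → ℝ) (α γ : ℝ)
    (u : V) (X : V → Bool) : ℝ :=
  if X u then
    (1 + α) * ∑ v, a v u * (1 - occ X v)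
      + γ * ∑ v, (1 - occ X v) * ∑ w, occ X w * b w (v, u)
  else
    ∑ v, a v u * occ X v + γ * ∑ v, occ X v * ∑ w, occ X w * b w (v, u)

/-- The generator `f ↦ ∑ u, c u X * (f (Xᵘ) - f X)` of the spin system with flip rates `c`. -/
def spinGenerator {V : Type*} [Fintype V] [DecidableEq V] (c : V → (V → Bool) → ℝ) :
    ((V → Bool) → ℝ) →L[ℝ] ((V → Bool) → ℝ) :=
  LinearMap.toContinuousLinearMap
    { toFun := fun f X => ∑ u, c u X * (f (flipAt X u) - f X)
      map_add' := fun f g => by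
        funext X
        simp only [Pi.add_apply, ← Finset.sum_add_distrib]
        exact Finset.sum_congr rfl fun u _ => by ring
      map_smul' := fun k f => by
        funext X
        simp only [Pi.smul_apply, smul_eq_mul, RingHom.id_apply, Finset.mul_sum]
        exact Finset.sum_congr rfl fun u _ => by ring }

open Classical in
/-- The cooperation kernel of the cooperative model: the two-step kernel `u → v → w` of the
self-avoiding random walk with step kernel `a`. -/
def coopKernel {V : Type*} [Fintype V] (a : V → V → ℝ) (u : V) (p : V × V) : ℝ :=
  if a p.1 u < 1 then
    a u p.1 * ((if p.2 ≠ u then a p.1 p.2 else 0) / ∑ w' with w' ≠ u, a p.1 w')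
  else 0

/-- The cooperative voter model with bias and cooperation (cVMBC) with step kernel `a`. -/
def IsCVMBC {Ω : Type*} [MeasurableSpace Ω] (P : Measure Ω)
    {V : Type*} [Fintype V] [DecidableEq V] (a : V → V → ℝ) (α γ : ℝ)
    (X : Ω → CadlagPath (V → Bool)) : Prop :=
  IsMarkovProcess P X (spinGenerator (vmbcRate a (coopKernel a) α γ))

open Classical in
/-- The step kernel of the complete graph: uniform on the other vertices. -/
def completeKernel (V : Type*) [Fintype V] (u v : V) : ℝ :=
  if u ≠ v then 1 / ((Fintype.card V : ℝ) - 1) else 0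

/-- The frequency of cooperators in a configuration. -/
def coopFreq {V : Type*} [Fintype V] (X : V → Bool) : ℝ :=
  1 / (Fintype.card V : ℝ) * ∑ u, occ X u

/-- The path of the frequency of cooperators. -/
def freqPath {V : Type*} [Fintype V] (x : CadlagPath (V → Bool)) : CadlagPath ℝ :=
  x.map coopFreq continuous_of_discreteTopology

/-- `S` solves `dS = -α S (1 - S)` on `[0, ∞)` with `S 0 = s₀` (one-sided derivative at `0`). -/
def IsLogisticSolution (α s₀ : ℝ) (S : ℝ≥0 → ℝ) : Prop :=
  S 0 = s₀ ∧ ∀ t : ℝ≥0,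
    HasDerivWithinAt (fun r : ℝ => S r.toNNReal) (-α * S t * (1 - S t)) (Ici 0) (t : ℝ)

end

/-!
On the complete graph the frequency `S` of cooperators has drift `-α S (1 - S) N / (N - 1)`: in
the drift the cooperation terms of births and deaths cancel, because the two-step kernel
`b w (v, u)` is symmetric in `v` and `u` (`sum_vmbcRate_mul`), so that `γ` only enters the
quadratic variation, which is of order `1 / N` (`spinGenerator_sq_sub_le`).

Let `φ t` be the logistic flow started in `S 0`. As the logistic vector field is Lipschitz on
`[0, 1]`, the process `(S t - φ t) ^ 2`, observed at the times `k h`, grows in mean per step by at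
most a factor `1 + 2 α h` and a summand of order `h / N` (`exists_exp_sq_sub_logisticFlow_le`). It
starts in `0` and is nonnegative, so a first passage argument (`IsMarkovProcess.maximal_ineq`)
controls its maximum over the grid, uniformly in `h`. Refining dyadic grids and using right
continuity, `sup_{t < T} |S t - φ t|` exceeds `ε` with probability of order `1 / N`
(`measure_deviation_le`).

The flow is continuous as a map from `[0, 1]` to the Skorokhod space
(`continuous_logisticPath`), so the flow started in `S 0` converges in distribution to the flow
started in `s₀` by the continuous mapping theorem. Uniform closeness on compacts implies
Skorokhod closeness, and the convergence passes to the frequency process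
(`TendstoInDistribution.of_forall_uniformity`). Measurability of the frequency process as a random
element of the Skorokhod space follows from the convergence of discretised paths
(`CadlagPath.tendsto_stepPath`, `CadlagPath.measurable_of_eval`).
-/

/-! ### The Skorokhod space: uniformity, discretisation and measurability -/

namespace CadlagPath

variable {E : Type*} [PseudoMetricSpace E]

theorem hasBasis_uniformity :
    (𝓤 (CadlagPath E)).HasBasis (fun p : ℝ≥0 × ℝ => 0 < p.2) (fun p => entourage p.1 p.2) := by
  refine ⟨fun U => ?_⟩
  have h : U ∈ 𝓤 (CadlagPath E) ↔ ∃ s ∈ (entourageBasis E).sets, s ⊆ U :=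
    (entourageBasis E).mem_filter_iff
  rw [h]
  constructor
  · rintro ⟨_, ⟨T, ε, hε, rfl⟩, hU⟩
    exact ⟨(T, ε), hε, hU⟩
  · rintro ⟨⟨T, ε⟩, hε, hU⟩
    exact ⟨_, ⟨T, ε, hε, rfl⟩, hU⟩

instance instIsCountablyGenerated : (𝓤 (CadlagPath E)).IsCountablyGenerated := by
  have hb : (𝓤 (CadlagPath E)).HasBasis (fun _ : ℕ => True)
      (fun n => entourage (n : ℝ≥0) (1 / ((n : ℝ) + 1))) := by
    refine hasBasis_uniformity.to_hasBasis (fun p hp => ?_) (fun n _ => ?_)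
    · obtain ⟨m, hm⟩ := exists_nat_ge p.1
      obtain ⟨k, hk⟩ := exists_nat_one_div_lt hp
      refine ⟨max m k, trivial, entourage_mono (hm.trans ?_) (le_trans ?_ hk.le)⟩
      · exact_mod_cast le_max_left m k
      · have : (k : ℝ) ≤ (max m k : ℕ) := by exact_mod_cast le_max_right m k
        gcongr
    · exact ⟨((n : ℝ≥0), 1 / ((n : ℝ) + 1)), by positivity, subset_rfl⟩
  exact HasCountableBasis.isCountablyGenerated ⟨hb, to_countable _⟩

theorem tendsto_nhds_iff {ι : Type*} {l : Filter ι} {y : ι → CadlagPath E} {x : CadlagPath E} :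
    Tendsto y l (𝓝 x) ↔
      ∀ (T : ℝ≥0) (ε : ℝ), 0 < ε → ∀ᶠ i in l, (x, y i) ∈ (entourage T ε : Set (_ × _)) := by
  rw [(nhds_basis_uniformity' hasBasis_uniformity).tendsto_right_iff]
  exact ⟨fun h T ε hε => h (T, ε) hε, fun h p hp => h p.1 p.2 hp⟩

/-- Uniform closeness on `[0, T]` is closeness in the Skorokhod sense: take the identity as time
change. -/
theorem mem_entourage_of_dist_le {x y : CadlagPath E} {T : ℝ≥0} {ε : ℝ} (hε : 0 ≤ ε)
    (h : ∀ t ≤ T, dist (x t) (y t) ≤ ε) : (x, y) ∈ (entourage T ε : Set (_ × _)) :=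
  ⟨OrderIso.refl _, fun t ht => ⟨by simpa using hε, h t ht⟩⟩

/-- The path that takes the value `a k` on `[k / (n + 1), (k + 1) / (n + 1))`. -/
noncomputable def stepPath (n : ℕ) (a : ℕ → E) : CadlagPath E where
  toFun t := a ⌊((n : ℝ≥0) + 1) * t⌋₊
  right_cont t := by
    have h : Tendsto (fun s : ℝ≥0 => ((n : ℝ≥0) + 1) * s) (𝓝[≥] t) (𝓝 (((n : ℝ≥0) + 1) * t)) :=
      ((continuous_const.mul continuous_id).tendsto t).mono_left nhdsWithin_le_nhds
    have h1 := h.eventually_lt_const (Nat.lt_floor_add_one (((n : ℝ≥0) + 1) * t))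
    refine (tendsto_const_nhds (x := a ⌊((n : ℝ≥0) + 1) * t⌋₊)).congr' ?_
    filter_upwards [h1, self_mem_nhdsWithin] with s hs hts
    congr 1
    symm
    rw [Nat.floor_eq_iff zero_le]
    exact ⟨(Nat.floor_le zero_le).trans (mul_le_mul_right (mem_Ici.1 hts) _), hs⟩
  left_lim t := by
    rcases eq_or_ne t 0 with rfl | ht
    · exact ⟨a 0, by simp⟩
    have hpos : 0 < ((n : ℝ≥0) + 1) * t := by positivity
    have hc : 0 < ⌈((n : ℝ≥0) + 1) * t⌉₊ := Nat.ceil_pos.2 hpos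
    obtain ⟨k, hk⟩ := Nat.exists_eq_succ_of_ne_zero hc.ne'
    have hk1 : (k : ℝ≥0) < ((n : ℝ≥0) + 1) * t := by
      rw [← Nat.lt_ceil, hk]; exact Nat.lt_succ_self k
    have hk2 : ((n : ℝ≥0) + 1) * t ≤ (k : ℝ≥0) + 1 := by
      have := Nat.le_ceil (((n : ℝ≥0) + 1) * t)
      rw [hk] at this
      exact_mod_cast this
    have h : Tendsto (fun s : ℝ≥0 => ((n : ℝ≥0) + 1) * s) (𝓝[<] t) (𝓝 (((n : ℝ≥0) + 1) * t)) :=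
      ((continuous_const.mul continuous_id).tendsto t).mono_left nhdsWithin_le_nhds
    refine ⟨a k, (tendsto_const_nhds (x := a k)).congr' ?_⟩
    filter_upwards [h.eventually_const_lt hk1, self_mem_nhdsWithin] with s hs hst
    congr 1
    symm
    rw [Nat.floor_eq_iff zero_le]
    exact ⟨hs.le, (mul_lt_mul_of_pos_left (mem_Iio.1 hst) (by positivity)).trans_le hk2⟩

theorem continuous_stepPath (n : ℕ) : Continuous (stepPath n : (ℕ → E) → CadlagPath E) := by
  refine continuous_iff_continuousAt.2 fun a => tendsto_nhds_iff.2 fun T ε hε => ?_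
  have h : ∀ᶠ b in 𝓝 a, ∀ k ∈ Finset.range (⌊((n : ℝ≥0) + 1) * T⌋₊ + 1), dist (a k) (b k) < ε := by
    rw [Filter.eventually_all_finset]
    intro k _
    have : Tendsto (fun b : ℕ → E => dist (a k) (b k)) (𝓝 a) (𝓝 (dist (a k) (a k))) :=
      (continuous_const.dist (continuous_apply k)).tendsto a
    rw [dist_self] at this
    exact this.eventually_lt_const hε
  filter_upwards [h] with b hb
  refine mem_entourage_of_dist_le hε.le fun t ht => (hb _ ?_).le
  rw [Finset.mem_range, Nat.lt_succ_iff]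
  exact Nat.floor_mono (mul_le_mul_right ht _)

/-- A time change can be altered after time `s` so as to take a prescribed value at a later
time: continue it linearly. -/
theorem exists_orderIso_extend (τ : ℝ≥0 ≃o ℝ≥0) {s q w : ℝ≥0} (hq : s < q) (hw : τ s < w) :
    ∃ σ : ℝ≥0 ≃o ℝ≥0, (∀ t ≤ s, σ t = τ t) ∧ σ q = w := by
  set c : ℝ≥0 := (w - τ s) / (q - s) with hc
  have hqs : 0 < q - s := tsub_pos_of_lt hq
  have hcpos : 0 < c := div_pos (tsub_pos_of_lt hw) hqs
  set f : ℝ≥0 → ℝ≥0 := fun t => τ (min t s) + c * (t - s) with hf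
  have hle : ∀ t ≤ s, f t = τ t := fun t ht => by
    simp only [hf, min_eq_left ht, tsub_eq_zero_of_le ht, mul_zero, add_zero]
  have hge : ∀ t, s ≤ t → f t = τ s + c * (t - s) := fun t ht => by
    simp only [hf, min_eq_right ht]
  have hmono : StrictMono f := by
    intro t u htu
    rcases le_or_gt u s with hu | hu
    · rw [hle t (htu.le.trans hu), hle u hu]
      exact τ.strictMono htu
    · rcases le_or_gt s t with ht | ht
      · rw [hge t ht, hge u hu.le]
        gcongr
        exact tsub_lt_tsub_right_of_le ht htu
      · rw [hle t ht.le, hge u hu.le]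
        exact (τ.strictMono ht).trans_le le_self_add
  have hsurj : Function.Surjective f := by
    intro y
    rcases le_or_gt y (τ s) with hy | hy
    · refine ⟨τ.symm y, ?_⟩
      rw [hle _ (by rwa [← τ.le_iff_le, τ.apply_symm_apply]), τ.apply_symm_apply]
    · refine ⟨s + (y - τ s) / c, ?_⟩
      rw [hge _ le_self_add, add_tsub_cancel_left, mul_div_cancel₀ _ hcpos.ne',
        add_tsub_cancel_of_le hy.le]
  refine ⟨hmono.orderIsoOfSurjective f hsurj, fun t ht => hle t ht, ?_⟩
  change f q = w
  rw [hge q hq.le, hc, div_mul_cancel₀ _ hqs.ne', add_tsub_cancel_of_le hw.le]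

/-- `[p, q)` is a nonempty interval of length at most `ε` on which the path `x` oscillates by at
most `ε`. -/
def SmallOsc (x : CadlagPath E) (ε : ℝ≥0) (p q : ℝ≥0) : Prop :=
  p < q ∧ q ≤ p + ε ∧ ∀ u ∈ Ico p q, ∀ v ∈ Ico p q, dist (x u) (x v) ≤ ε

/-- Any time is exceeded by the last point of a finite partition into intervals of small
oscillation: otherwise the left limit at the supremum of the reachable points would make the
supremum reachable, and right continuity would allow to go beyond it. -/
theorem exists_partition (x : CadlagPath E) {ε : ℝ≥0} (hε : 0 < ε) (T : ℝ≥0) :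
    ∃ s, T < s ∧ Relation.ReflTransGen (SmallOsc x ε) 0 s := by
  by_contra! hcon
  set S : Set ℝ≥0 := {s | Relation.ReflTransGen (SmallOsc x ε) 0 s} with hS
  have h0 : (0 : ℝ≥0) ∈ S := Relation.ReflTransGen.refl
  have hbdd : BddAbove S := ⟨T, fun s hs => not_lt.1 fun h => hcon s h hs⟩
  set m := sSup S with hm
  have hosc : ∀ (l : E) (u v : ℝ≥0), dist (x u) l < ε / 2 → dist (x v) l < ε / 2 →
      dist (x u) (x v) ≤ ε := fun l u v hu hv => by
    linarith [dist_triangle_right (x u) (x v) l]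
  have hε2 : (0 : ℝ) < ε / 2 := half_pos (by exact_mod_cast hε)
  have hmS : m ∈ S := by
    rcases eq_or_ne m 0 with h | h
    · rwa [h]
    have hmpos : 0 < m := pos_iff_ne_zero.2 h
    obtain ⟨l, hl⟩ := x.left_lim m
    have h1 : {u | dist (x u) l < ε / 2} ∈ 𝓝[<] m := hl (Metric.ball_mem_nhds l hε2)
    obtain ⟨p, hp, hpm⟩ := (mem_nhdsLT_iff_exists_Ioo_subset' hmpos).1 h1
    obtain ⟨r, hr, hpr⟩ := exists_lt_of_lt_csSup ⟨0, h0⟩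
      (show max p (m - ε) < sSup S from max_lt hp (tsub_lt_self hmpos hε))
    rcases (le_csSup hbdd hr).eq_or_lt with hrm | hrm
    · rwa [← hm, hrm.symm] at *
    have hsub : ∀ u ∈ Ico r m, dist (x u) l < ε / 2 := fun u hu =>
      hpm ⟨(le_max_left _ _).trans_lt (hpr.trans_le hu.1), hu.2⟩
    refine Relation.ReflTransGen.tail hr ⟨hrm, ?_, fun u hu v hv =>
      hosc l u v (hsub u hu) (hsub v hv)⟩
    exact tsub_le_iff_right.1 ((le_max_right _ _).trans hpr.le)
  have h2 : {u | dist (x u) (x m) < ε / 2} ∈ 𝓝[≥] m :=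
    x.right_cont m (Metric.ball_mem_nhds _ hε2)
  obtain ⟨q, hq, hqm⟩ := (mem_nhdsGE_iff_exists_Ico_subset' (lt_add_one m)).1 h2
  have hq' : m < min q (m + ε) := lt_min hq (lt_add_of_pos_right _ hε)
  have hsub : ∀ u ∈ Ico m (min q (m + ε)), dist (x u) (x m) < ε / 2 := fun u hu =>
    hqm ⟨hu.1, hu.2.trans_le (min_le_left _ _)⟩
  have : min q (m + ε) ∈ S := Relation.ReflTransGen.tail hmS
    ⟨hq', min_le_right _ _, fun u hu v hv => hosc _ u v (hsub u hu) (hsub v hv)⟩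
  exact (le_csSup hbdd this).not_gt hq'

/-- The time change maps each partition point `p` to `⌈(n + 1) p⌉ / (n + 1)`, so that `t` and the
grid point to the left of its image lie in the same interval of the partition. -/
theorem eventually_exists_orderIso (x : CadlagPath E) {ε : ℝ≥0} (hε : 0 < ε) {s : ℝ≥0}
    (hs : Relation.ReflTransGen (SmallOsc x ε) 0 s) :
    ∀ᶠ n : ℕ in atTop, ∃ τ : ℝ≥0 ≃o ℝ≥0,
      τ s = ⌈((n : ℝ≥0) + 1) * s⌉₊ / ((n : ℝ≥0) + 1) ∧ ∀ t < s, dist (τ t) t ≤ 2 * ε ∧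
        dist (x t) (x (⌊((n : ℝ≥0) + 1) * τ t⌋₊ / ((n : ℝ≥0) + 1))) ≤ ε := by
  induction hs with
  | refl => exact Eventually.of_forall fun n => ⟨OrderIso.refl _, by simp⟩
  | @tail p q _ hpq ih =>
    obtain ⟨hlt, hle, hosc⟩ := hpq
    have hlim : Tendsto (fun n : ℕ => 1 / ((n : ℝ≥0) + 1)) atTop (𝓝 0) :=
      tendsto_one_div_add_atTop_nhds_zero_nat
    filter_upwards [ih, hlim.eventually_lt_const (tsub_pos_of_lt hlt),
      hlim.eventually_lt_const hε] with n ⟨τ, hτp, hτ⟩ hn1 hn2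
    set c : ℝ≥0 := (n : ℝ≥0) + 1 with hc
    have hcpos : 0 < c := by positivity
    have hup : ∀ r : ℝ≥0, (⌈c * r⌉₊ : ℝ≥0) / c ≤ r + 1 / c := fun r => by
      rw [div_le_iff₀ hcpos, add_mul r, one_div_mul_cancel hcpos.ne', mul_comm r]
      exact (Nat.ceil_lt_add_one zero_le).le
    have hlo : ∀ r : ℝ≥0, r ≤ (⌈c * r⌉₊ : ℝ≥0) / c := fun r => by
      rw [le_div_iff₀ hcpos, mul_comm]
      exact Nat.le_ceil _
    have hw : τ p < ⌈c * q⌉₊ / c := by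
      rw [hτp]
      refine (hup p).trans_lt (lt_of_lt_of_le ?_ (hlo q))
      rw [add_comm]
      exact lt_tsub_iff_right.1 hn1
    obtain ⟨σ, hσ, hσq⟩ := exists_orderIso_extend τ hlt hw
    refine ⟨σ, hσq, fun t ht => ?_⟩
    rcases lt_or_ge t p with htp | htp
    · rw [hσ t htp.le]
      exact hτ t htp
    have h1 : (⌈c * p⌉₊ : ℝ≥0) / c ≤ σ t := by
      rw [← hτp, ← hσ p le_rfl]
      exact σ.monotone htp
    have h2 : σ t < ⌈c * q⌉₊ / c := by
      rw [← hσq]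
      exact σ.strictMono ht
    constructor
    · have e1 : (t : ℝ) < q := by exact_mod_cast ht
      have e2 : (p : ℝ) ≤ t := by exact_mod_cast htp
      have e3 : (q : ℝ) ≤ p + ε := by exact_mod_cast hle
      have e4 : (p : ℝ) ≤ σ t := by exact_mod_cast (hlo p).trans h1
      have e5 : (σ t : ℝ) < q + ε := by
        exact_mod_cast h2.trans_le ((hup q).trans (add_le_add_right hn2.le q))
      rw [NNReal.dist_eq, abs_le]
      constructor <;> linarith
    · refine hosc t ⟨htp, ht⟩ _ ⟨?_, ?_⟩
      · refine (hlo p).trans ?_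
        gcongr
        refine Nat.le_floor ?_
        rw [mul_comm c (σ t)]
        exact (div_le_iff₀ hcpos).1 h1
      · rw [div_lt_iff₀ hcpos, mul_comm q]
        refine Nat.lt_ceil.1 (Nat.floor_lt' ?_ |>.2 ?_)
        · have : 0 < ⌈c * q⌉₊ := Nat.ceil_pos.2 (mul_pos hcpos hlt.bot_lt)
          exact this.ne'
        · rw [mul_comm c (σ t)]
          exact (lt_div_iff₀ hcpos).1 h2

/-- The discretisations of a càdlàg path along finer and finer grids converge to the path in the
Skorokhod topology. -/
theorem tendsto_stepPath (x : CadlagPath E) :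
    Tendsto (fun n : ℕ => stepPath n fun k => x (k / ((n : ℝ≥0) + 1))) atTop (𝓝 x) := by
  refine tendsto_nhds_iff.2 fun T ε hε => ?_
  lift ε to ℝ≥0 using hε.le
  have hε' : 0 < ε / 2 := half_pos (by exact_mod_cast hε)
  obtain ⟨s, hTs, hs⟩ := exists_partition x hε' T
  filter_upwards [eventually_exists_orderIso x hε' hs] with n ⟨τ, _, hτ⟩
  refine ⟨τ, fun t ht => ?_⟩
  obtain ⟨h1, h2⟩ := hτ t (ht.trans_lt hTs)
  push_cast at h1 h2
  have : (0 : ℝ) ≤ ε := ε.2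
  exact ⟨by linarith, h2.trans (by linarith)⟩

/-- A random càdlàg path with measurable evaluations is measurable for the Borel `σ`-algebra of the
Skorokhod topology. -/
theorem measurable_of_eval [SecondCountableTopology E] [MeasurableSpace E] [BorelSpace E]
    {Ω : Type*} [MeasurableSpace Ω] {X : Ω → CadlagPath E}
    (h : ∀ t, Measurable fun ω => X ω t) : Measurable X := by
  refine measurable_of_tendsto_metrizable
    (f := fun n ω => stepPath n fun k => X ω (k / ((n : ℝ≥0) + 1))) (fun n => ?_)
    (tendsto_pi_nhds.2 fun ω => tendsto_stepPath (X ω))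
  exact (continuous_stepPath n).measurable.comp (measurable_pi_lambda _ fun k => h _)

end CadlagPath

/-! ### Convergence together -/

/-- A converging-together lemma in uniform spaces: if `X i` converges in distribution and `Y i` is
close to `X i` with probability tending to one, then `Y i` converges to the same limit. The
exceptional sets need not be measurable. -/
theorem MeasureTheory.TendstoInDistribution.of_forall_uniformity {ι E Ω' : Type*} {Ω : ι → Type*}
    {m : ∀ i, MeasurableSpace (Ω i)} {μ : (i : ι) → Measure (Ω i)} [∀ i, IsProbabilityMeasure (μ i)]
    {m' : MeasurableSpace Ω'} {μ' : Measure Ω'} [IsProbabilityMeasure μ']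
    {l : Filter ι} [l.IsCountablyGenerated]
    [UniformSpace E] [(𝓤 E).IsCountablyGenerated] [MeasurableSpace E] [BorelSpace E]
    {X Y : (i : ι) → Ω i → E} {Z : Ω' → E}
    (hX : TendstoInDistribution X l Z μ μ') (hY : ∀ i, AEMeasurable (Y i) (μ i))
    (h : ∀ U ∈ 𝓤 E, Tendsto (fun i => μ i {ω | (X i ω, Y i ω) ∉ U}) l (𝓝 0)) :
    TendstoInDistribution Y l Z μ μ' := by
  let := UniformSpace.pseudoMetricSpace E
  refine ⟨hY, hX.aemeasurable_limit, ?_⟩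
  refine tendsto_iff_forall_lipschitz_integral_tendsto.2 ?_
  rintro F ⟨C, hC⟩ ⟨K, hK⟩
  have hXt := (tendsto_iff_forall_lipschitz_integral_tendsto.1 hX.tendsto) F ⟨C, hC⟩ ⟨K, hK⟩
  have hFm : Measurable F := hK.continuous.measurable
  have hXm := hX.forall_aemeasurable
  simp only [ProbabilityMeasure.coe_mk] at hXt ⊢
  simp_rw [integral_map (hXm _) hFm.aestronglyMeasurable] at hXt
  simp_rw [integral_map (hY _) hFm.aestronglyMeasurable]
  suffices hd : Tendsto (fun i => ∫ ω, F (Y i ω) ∂μ i - ∫ ω, F (X i ω) ∂μ i) l (𝓝 0) by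
    simpa using hd.add hXt
  rw [Metric.tendsto_nhds]
  intro ε hε
  have hU : {p : E × E | dist (F p.1) (F p.2) < ε / 2} ∈ 𝓤 E :=
    hK.uniformContinuous (Metric.dist_mem_uniformity (half_pos hε))
  have hlim : Tendsto (fun i => ε / 2 + C *
      (μ i {ω | (X i ω, Y i ω) ∉ {p : E × E | dist (F p.1) (F p.2) < ε / 2}}).toReal) l
      (𝓝 (ε / 2 + C * 0)) :=
    (((ENNReal.tendsto_toReal (by simp)).comp (h _ hU)).const_mul C).const_add _
  filter_upwards [hlim.eventually_lt_const (show ε / 2 + C * 0 < ε by linarith)] with i hi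
  refine lt_of_le_of_lt ?_ hi
  obtain ⟨ω₀⟩ := (μ i).nonempty_of_neZero
  have hC0 : 0 ≤ C := by simpa using hC (X i ω₀) (X i ω₀)
  have hint : ∀ W : Ω i → E, AEMeasurable W (μ i) → Integrable (fun ω => F (W ω)) (μ i) :=
    fun W hW => by
      refine Integrable.of_bound (hFm.comp_aemeasurable hW).aestronglyMeasurable
        (‖F (X i ω₀)‖ + C) (ae_of_all _ fun ω => ?_)
      have := norm_le_norm_add_norm_sub' (F (W ω)) (F (X i ω₀))
      rw [← dist_eq_norm] at this
      exact this.trans (by gcongr; exact hC _ _)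
  -- A measurable hull, since `E` need not be second countable and the set need not be measurable.
  set B := toMeasurable (μ i) {ω | (X i ω, Y i ω) ∉ {p : E × E | dist (F p.1) (F p.2) < ε / 2}}
    with hB
  have hBm : MeasurableSet B := measurableSet_toMeasurable _ _
  rw [dist_zero_right, ← integral_sub (hint _ (hY i)) (hint _ (hXm i))]
  calc ‖∫ ω, (F (Y i ω) - F (X i ω)) ∂μ i‖
      ≤ ∫ ω, (ε / 2 + B.indicator (fun _ => C) ω) ∂μ i := by
        refine norm_integral_le_of_norm_le
          ((integrable_const _).add ((integrable_const C).indicator hBm)) (ae_of_all _ fun ω => ?_)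
        by_cases hω : ω ∈ B
        · rw [indicator_of_mem hω, ← dist_eq_norm]
          linarith [hC (Y i ω) (X i ω)]
        · rw [indicator_of_notMem hω, ← dist_eq_norm, dist_comm, add_zero]
          by_contra hcon
          exact hω (subset_toMeasurable _ _ fun h => hcon (le_of_lt h))
    _ = _ := by
        rw [integral_add (integrable_const _) ((integrable_const C).indicator hBm),
          integral_indicator hBm]
        simp [hB, Measure.real, mul_comm]

/-! ### The logistic flow -/

section Logistic

/-- The denominator of the logistic flow. -/
noncomputable def logisticDenom (α x t : ℝ) : ℝ := 1 - x + x * Real.exp (-α * t)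

/-- The value at time `t` of the solution of `dS = -α S (1 - S)` started in `x`. -/
noncomputable def logisticFlow (α x t : ℝ) : ℝ := x * Real.exp (-α * t) / logisticDenom α x t

variable {α x y t : ℝ}

theorem logisticDenom_pos (hx : x ∈ Icc (0 : ℝ) 1) : 0 < logisticDenom α x t := by
  have h := Real.exp_pos (-α * t)
  unfold logisticDenom
  rcases hx.1.eq_or_lt with h0 | h0
  · simp [← h0]
  · have := mul_pos h0 h
    linarith [hx.2]

theorem logisticFlow_mem_Icc (hx : x ∈ Icc (0 : ℝ) 1) : logisticFlow α x t ∈ Icc (0 : ℝ) 1 := by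
  have h := Real.exp_pos (-α * t)
  refine ⟨div_nonneg (mul_nonneg hx.1 h.le) (logisticDenom_pos hx).le, ?_⟩
  rw [logisticFlow, div_le_one (logisticDenom_pos hx), logisticDenom]
  linarith [hx.2]

theorem logisticFlow_zero : logisticFlow α x 0 = x := by
  simp [logisticFlow, logisticDenom]

theorem hasDerivAt_logisticFlow (hx : x ∈ Icc (0 : ℝ) 1) (t : ℝ) :
    HasDerivAt (logisticFlow α x)
      (-α * logisticFlow α x t * (1 - logisticFlow α x t)) t := by
  have hD := (logisticDenom_pos (α := α) (t := t) hx).ne'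
  have he : HasDerivAt (fun t : ℝ => x * Real.exp (-α * t)) (x * (Real.exp (-α * t) * (-α))) t := by
    have := (((hasDerivAt_id t).const_mul (-α)).exp).const_mul x
    simpa using this
  have := he.div (he.const_add (1 - x)) hD
  refine this.congr_deriv ?_
  change _ / logisticDenom α x t ^ 2 = _
  have h1 : 1 - x + x * Real.exp (-α * t) = logisticDenom α x t := rfl
  simp only [h1]
  rw [logisticFlow]
  field_simp
  rw [← h1]
  ring

theorem continuous_logisticFlow (hx : x ∈ Icc (0 : ℝ) 1) : Continuous (logisticFlow α x) :=
  continuous_iff_continuousAt.2 fun t => (hasDerivAt_logisticFlow hx t).continuousAt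

theorem abs_logisticFlow_sub_le (hα : 0 ≤ α) (hx : x ∈ Icc (0 : ℝ) 1) (hy : y ∈ Icc (0 : ℝ) 1)
    {T : ℝ} (ht : t ∈ Icc 0 T) :
    |logisticFlow α x t - logisticFlow α y t| ≤ Real.exp (α * T) * |x - y| := by
  have hDx := logisticDenom_pos (α := α) (t := t) hx
  have hDy := logisticDenom_pos (α := α) (t := t) hy
  set e := Real.exp (-α * t) with he
  have he0 : 0 < e := Real.exp_pos _
  have he1 : e ≤ 1 := Real.exp_le_one_iff.2 (by nlinarith [ht.1])
  have hge : ∀ z ∈ Icc (0 : ℝ) 1, e ≤ logisticDenom α z t := fun z hz => by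
    unfold logisticDenom
    nlinarith [hz.1, hz.2]
  have heq : logisticFlow α x t - logisticFlow α y t
      = e / (logisticDenom α x t * logisticDenom α y t) * (x - y) := by
    rw [logisticFlow, logisticFlow, div_sub_div _ _ hDx.ne' hDy.ne', div_mul_eq_mul_div]
    congr 1
    simp only [logisticDenom]
    ring
  rw [heq, abs_mul, abs_of_pos (by positivity)]
  refine mul_le_mul_of_nonneg_right ?_ (abs_nonneg _)
  calc e / (logisticDenom α x t * logisticDenom α y t) ≤ e / (e * e) := by
        gcongr
        exacts [hge x hx, hge y hy]
    _ = Real.exp (α * t) := by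
        rw [div_mul_cancel_left₀ he0.ne', he, ← Real.exp_neg]
        congr 1; ring
    _ ≤ Real.exp (α * T) := by
        gcongr
        exact ht.2

theorem abs_logistic_sub_le (hα : 0 ≤ α) {M : ℝ} (hx : |x| ≤ M) (hy : |y| ≤ M) :
    |-α * x * (1 - x) - -α * y * (1 - y)| ≤ α * (1 + 2 * M) * |x - y| := by
  have : -α * x * (1 - x) - -α * y * (1 - y) = α * ((x + y - 1) * (x - y)) := by ring
  rw [this, abs_mul, abs_mul, abs_of_nonneg hα, ← mul_assoc]
  gcongr
  rw [abs_le] at *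
  constructor <;> linarith

theorem abs_logistic_sub_le_of_mem_Icc (hα : 0 ≤ α) (hx : x ∈ Icc (0 : ℝ) 1)
    (hy : y ∈ Icc (0 : ℝ) 1) :
    |-α * x * (1 - x) - -α * y * (1 - y)| ≤ α * |x - y| := by
  have : -α * x * (1 - x) - -α * y * (1 - y) = α * ((x + y - 1) * (x - y)) := by ring
  rw [this, abs_mul, abs_mul, abs_of_nonneg hα]
  have h1 : |x + y - 1| ≤ 1 := abs_le.2 ⟨by linarith [hx.1, hy.1], by linarith [hx.2, hy.2]⟩
  have := mul_le_mul_of_nonneg_right h1 (abs_nonneg (x - y))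
  exact mul_le_mul_of_nonneg_left (by linarith) hα

theorem abs_logisticFlow_add_sub_le (hα : 0 ≤ α) (hx : x ∈ Icc (0 : ℝ) 1) {h : ℝ} (hh : 0 ≤ h) :
    |logisticFlow α x (t + h) - logisticFlow α x t| ≤ α * h := by
  have hb : ∀ s ∈ Icc t (t + h),
      ‖-α * logisticFlow α x s * (1 - logisticFlow α x s)‖ ≤ α := fun s _ => by
    obtain ⟨h0, h1⟩ := logisticFlow_mem_Icc (α := α) (t := s) hx
    rw [Real.norm_eq_abs, mul_assoc, abs_mul, abs_neg, abs_of_nonneg hα,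
      abs_of_nonneg (mul_nonneg h0 (by linarith))]
    exact mul_le_of_le_one_right hα (by nlinarith)
  have := (convex_Icc t (t + h)).norm_image_sub_le_of_norm_hasDerivWithin_le
    (fun s _ => (hasDerivAt_logisticFlow (α := α) hx s).hasDerivWithinAt) hb
    (left_mem_Icc.2 (by linarith)) (right_mem_Icc.2 (by linarith))
  simpa [abs_of_nonneg hh] using this

/-- The Euler step of the logistic equation is accurate to second order. -/
theorem abs_logisticFlow_euler_le (hα : 0 ≤ α) (hx : x ∈ Icc (0 : ℝ) 1) {h : ℝ} (hh : 0 ≤ h) :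
    |logisticFlow α x (t + h) - logisticFlow α x t
      - h * (-α * logisticFlow α x t * (1 - logisticFlow α x t))| ≤ α ^ 2 * h ^ 2 := by
  set d := -α * logisticFlow α x t * (1 - logisticFlow α x t) with hd
  have hb : ∀ s ∈ Icc t (t + h),
      ‖-α * logisticFlow α x s * (1 - logisticFlow α x s) - d‖ ≤ α * (α * h) := fun s hs => by
    refine (abs_logistic_sub_le_of_mem_Icc hα (logisticFlow_mem_Icc hx)
      (logisticFlow_mem_Icc hx)).trans (mul_le_mul_of_nonneg_left ?_ hα)
    have := abs_logisticFlow_add_sub_le (t := t) hα hx (sub_nonneg.2 hs.1)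
    rw [add_sub_cancel] at this
    exact this.trans (mul_le_mul_of_nonneg_left (by linarith [hs.2]) hα)
  have := (convex_Icc t (t + h)).norm_image_sub_le_of_norm_hasDerivWithin_le
    (fun s _ => ((hasDerivAt_logisticFlow (α := α) hx s).sub
      ((hasDerivAt_id s).mul_const d)).hasDerivWithinAt) (C := α * (α * h))
    (fun s hs => by simpa using hb s hs)
    (left_mem_Icc.2 (by linarith)) (right_mem_Icc.2 (by linarith))
  simp only [add_sub_cancel_left, Real.norm_eq_abs, abs_of_nonneg hh, Pi.sub_apply, id] at this
  calc _ = |logisticFlow α x (t + h) - (t + h) * d - (logisticFlow α x t - t * d)| := by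
        congr 1; ring
    _ ≤ α * (α * h) * h := this
    _ = α ^ 2 * h ^ 2 := by ring

/-- The orthogonal projection of `ℝ` onto `[0, 1]`. -/
def clampUnit (x : ℝ) : ℝ := max 0 (min x 1)

theorem clampUnit_mem (x : ℝ) : clampUnit x ∈ Icc (0 : ℝ) 1 :=
  ⟨le_max_left _ _, max_le zero_le_one (min_le_right _ _)⟩

theorem clampUnit_of_mem (hx : x ∈ Icc (0 : ℝ) 1) : clampUnit x = x := by
  rw [clampUnit, min_eq_left hx.2, max_eq_right hx.1]

theorem continuous_clampUnit : Continuous clampUnit := by unfold clampUnit; fun_prop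

/-- A continuous function on `[0, ∞)` as a càdlàg path. -/
def CadlagPath.ofContinuous {E : Type*} [TopologicalSpace E] (f : ℝ≥0 → E) (hf : Continuous f) :
    CadlagPath E where
  toFun := f
  right_cont _ := hf.continuousWithinAt
  left_lim t := ⟨f t, (hf.tendsto t).mono_left nhdsWithin_le_nhds⟩

/-- The path of the logistic flow started in the projection of `x` to `[0, 1]`; outside of this
interval the flow may explode. -/
noncomputable def logisticPath (α x : ℝ) : CadlagPath ℝ :=
  .ofContinuous (fun t => logisticFlow α (clampUnit x) t)
    ((continuous_logisticFlow (clampUnit_mem x)).comp NNReal.continuous_coe)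

theorem logisticPath_apply (hx : x ∈ Icc (0 : ℝ) 1) (t : ℝ≥0) :
    logisticPath α x t = logisticFlow α x t := by
  rw [← clampUnit_of_mem hx]
  simp [logisticPath, CadlagPath.ofContinuous, clampUnit_of_mem hx]

theorem continuous_logisticPath (hα : 0 ≤ α) : Continuous (logisticPath α) := by
  refine continuous_iff_continuousAt.2 fun x =>
    CadlagPath.tendsto_nhds_iff.2 fun T ε hε => ?_
  have h : Tendsto (fun y => Real.exp (α * T) * |clampUnit x - clampUnit y|) (𝓝 x)
      (𝓝 (Real.exp (α * T) * |clampUnit x - clampUnit x|)) :=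
    (((continuous_const.sub continuous_clampUnit).abs).const_mul _).tendsto x
  simp only [sub_self, abs_zero, mul_zero] at h
  filter_upwards [h.eventually_lt_const hε] with y hy
  refine CadlagPath.mem_entourage_of_dist_le hε.le fun t ht => ?_
  exact (abs_logisticFlow_sub_le hα (clampUnit_mem x) (clampUnit_mem y)
    ⟨t.2, NNReal.coe_le_coe.2 ht⟩).trans hy.le

theorem isLogisticSolution_logisticPath (hx : x ∈ Icc (0 : ℝ) 1) :
    IsLogisticSolution α x (logisticPath α x) := by
  refine ⟨by simp [logisticPath_apply hx, logisticFlow_zero], fun t => ?_⟩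
  rw [logisticPath_apply hx]
  refine (hasDerivAt_logisticFlow hx (t : ℝ)).hasDerivWithinAt.congr (fun r hr => ?_) ?_
  · rw [logisticPath_apply hx, Real.coe_toNNReal _ hr]
  · simp [logisticPath_apply hx]

theorem IsLogisticSolution.eq_logisticFlow (hα : 0 ≤ α) (hx : x ∈ Icc (0 : ℝ) 1) {S : ℝ≥0 → ℝ}
    (hS : IsLogisticSolution α x S) (t : ℝ≥0) : S t = logisticFlow α x t := by
  set f : ℝ → ℝ := fun r => S r.toNNReal with hf
  have hderiv : ∀ r : ℝ, 0 ≤ r → HasDerivWithinAt f (-α * f r * (1 - f r)) (Ici 0) r :=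
    fun r hr => by
      have := hS.2 r.toNNReal
      rwa [Real.coe_toNNReal r hr] at this
  have hcont : ContinuousOn f (Icc 0 (t : ℝ)) := fun r hr =>
    (hderiv r hr.1).continuousWithinAt.mono Icc_subset_Ici_self
  obtain ⟨M, hM⟩ := isCompact_Icc.exists_bound_of_continuousOn hcont
  have hM1 : ∀ r ∈ Icc 0 (t : ℝ), |f r| ≤ max M 1 := fun r hr => (hM r hr).trans (le_max_left _ _)
  have key : EqOn f (logisticFlow α x) (Icc 0 (t : ℝ)) := by
    refine ODE_solution_unique_of_mem_Icc_right (v := fun _ y => -α * y * (1 - y))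
      (s := fun _ => {y | |y| ≤ max M 1}) (K := (α * (1 + 2 * max M 1)).toNNReal)
      (fun r _ => LipschitzOnWith.of_dist_le_mul fun y hy z hz => ?_) hcont
      (fun r hr => (hderiv r hr.1).mono (Ici_subset_Ici.2 hr.1))
      (fun r hr => hM1 r (Ico_subset_Icc_self hr)) (continuous_logisticFlow hx).continuousOn
      (fun r _ => (hasDerivAt_logisticFlow hx r).hasDerivWithinAt) (fun r _ => ?_) ?_
    · rw [Real.coe_toNNReal _ (mul_nonneg hα (by positivity))]
      exact abs_logistic_sub_le hα hy hz
    · obtain ⟨h0, h1⟩ := logisticFlow_mem_Icc (α := α) (t := r) hx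
      exact (abs_le.2 ⟨by linarith, h1⟩).trans (le_max_right _ _)
    · simp [hf, hS.1, logisticFlow_zero]
  have := key (right_mem_Icc.2 t.2)
  simpa [hf] using this

end Logistic

/-! ### The generator on functions of the frequency -/

theorem occ_nonneg {V : Type*} (X : V → Bool) (u : V) : 0 ≤ occ X u := by
  unfold occ; split_ifs <;> norm_num

theorem occ_le_one {V : Type*} (X : V → Bool) (u : V) : occ X u ≤ 1 := by
  unfold occ; split_ifs <;> norm_num

section Generator

variable {V : Type*} [Fintype V]

theorem coopFreq_mem_Icc (X : V → Bool) : coopFreq X ∈ Icc (0 : ℝ) 1 := by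
  have h1 : ∑ u, occ X u ≤ Fintype.card V := by
    calc ∑ u, occ X u ≤ ∑ _u : V, (1 : ℝ) := Finset.sum_le_sum fun u _ => occ_le_one X u
      _ = Fintype.card V := by simp
  have h0 : 0 ≤ ∑ u, occ X u := Finset.sum_nonneg fun u _ => occ_nonneg X u
  refine ⟨by unfold coopFreq; positivity, ?_⟩
  rw [coopFreq, one_div, inv_mul_eq_div]
  exact div_le_one_of_le₀ h1 (Nat.cast_nonneg _)

theorem completeKernel_comm (u v : V) : completeKernel V u v = completeKernel V v u := by
  classical exact if_congr ne_comm rfl rfl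

theorem sum_completeKernel_mul (φ : V → ℝ) (u : V) :
    ∑ v, completeKernel V u v * φ v = (∑ v, φ v - φ u) / ((Fintype.card V : ℝ) - 1) := by
  classical
  have h : ∀ v, completeKernel V u v * φ v
      = φ v / ((Fintype.card V : ℝ) - 1)
        - if u = v then φ v / ((Fintype.card V : ℝ) - 1) else 0 := by
    intro v
    unfold completeKernel
    by_cases huv : u = v
    · simp [huv]
    · simp [huv, div_eq_inv_mul]
  simp_rw [h, Finset.sum_sub_distrib]
  rw [Finset.sum_ite_eq]
  simp [Finset.sum_div, sub_div]

open Classical in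
/-- On the complete graph with at least three vertices, the self-avoiding two-step walk is uniform
on the pairs of further distinct vertices. -/
theorem coopKernel_completeKernel (hV : 3 ≤ Fintype.card V) (w v u : V) :
    coopKernel (completeKernel V) w (v, u) = if w ≠ v ∧ v ≠ u ∧ u ≠ w then
      1 / (((Fintype.card V : ℝ) - 1) * ((Fintype.card V : ℝ) - 2)) else 0 := by
  have hN : (3 : ℝ) ≤ Fintype.card V := by exact_mod_cast hV
  set N : ℝ := (Fintype.card V : ℝ) with hNdef
  have hlt : completeKernel V v w < 1 := by
    unfold completeKernel
    split_ifs
    · rw [div_lt_one (by linarith)]; linarith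
    · norm_num
  have hsum : w ≠ v → ∑ w' with w' ≠ w, completeKernel V v w' = (N - 2) / (N - 1) := by
    intro hwv
    have h := sum_completeKernel_mul (fun x => if x ≠ w then (1 : ℝ) else 0) v
    simp only [mul_ite, mul_one, mul_zero] at h
    rw [Finset.sum_filter, h]
    simp only [hwv.symm, ne_eq, not_false_eq_true, if_true, Finset.sum_ite, Finset.sum_const_zero,
      Finset.sum_const, nsmul_eq_mul, mul_one, add_zero]
    rw [Finset.filter_ne' Finset.univ w, Finset.card_erase_of_mem (Finset.mem_univ _),
      Finset.card_univ, Nat.cast_sub (by omega), ← hNdef]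
    congr 1
    push_cast
    ring
  simp only [coopKernel, hlt, if_true]
  by_cases hwv : w = v
  · simp [hwv, completeKernel]
  rw [hsum hwv]
  by_cases huw : u = w
  · simp [huw]
  by_cases hvu : v = u
  · simp [hvu, completeKernel]
  simp only [completeKernel, ne_eq, hwv, huw, hvu, not_false_eq_true, if_true, and_self, ← hNdef]
  have h1 : N - 1 ≠ 0 := by linarith
  have h2 : N - 2 ≠ 0 := by linarith
  field_simp

theorem coopKernel_completeKernel_comm (hV : 3 ≤ Fintype.card V) (w v u : V) :
    coopKernel (completeKernel V) w (v, u) = coopKernel (completeKernel V) w (u, v) := by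
  classical
  rw [coopKernel_completeKernel hV, coopKernel_completeKernel hV]
  refine if_congr ?_ rfl rfl
  grind

theorem coopKernel_completeKernel_mem_Icc (hV : 3 ≤ Fintype.card V) (w v u : V) :
    coopKernel (completeKernel V) w (v, u) ∈ Icc (0 : ℝ) (5 / (Fintype.card V : ℝ) ^ 2) := by
  classical
  have hN : (3 : ℝ) ≤ Fintype.card V := by exact_mod_cast hV
  rw [coopKernel_completeKernel hV]
  have hpos : 0 < ((Fintype.card V : ℝ) - 1) * ((Fintype.card V : ℝ) - 2) :=
    mul_pos (by linarith) (by linarith)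
  split_ifs
  · refine ⟨by positivity, ?_⟩
    rw [div_le_div_iff₀ hpos (by positivity)]
    nlinarith
  · exact ⟨le_rfl, by positivity⟩

variable {α γ : ℝ}

/-- The cooperation terms of the flip rates are bounded uniformly in the number of vertices. -/
theorem sum_coopKernel_le (hV : 3 ≤ Fintype.card V) {φ ψ : V → ℝ} (hφ : ∀ v, φ v ∈ Icc (0 : ℝ) 1)
    (hψ : ∀ v, ψ v ∈ Icc (0 : ℝ) 1) (u : V) :
    ∑ v, φ v * ∑ w, ψ w * coopKernel (completeKernel V) w (v, u) ∈ Icc (0 : ℝ) 5 := by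
  have hN : (3 : ℝ) ≤ Fintype.card V := by exact_mod_cast hV
  have hb := fun w v => coopKernel_completeKernel_mem_Icc hV w v u
  have h0 : ∀ v, 0 ≤ ∑ w, ψ w * coopKernel (completeKernel V) w (v, u) := fun v =>
    Finset.sum_nonneg fun w _ => mul_nonneg (hψ w).1 (hb w v).1
  refine ⟨Finset.sum_nonneg fun v _ => mul_nonneg (hφ v).1 (h0 v), ?_⟩
  calc ∑ v, φ v * ∑ w, ψ w * coopKernel (completeKernel V) w (v, u)
      ≤ ∑ _v : V, ∑ _w : V, 5 / (Fintype.card V : ℝ) ^ 2 := by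
        refine Finset.sum_le_sum fun v _ => (mul_le_of_le_one_left (h0 v) (hφ v).2).trans
          (Finset.sum_le_sum fun w _ =>
            (mul_le_of_le_one_left (hb w v).1 (hψ w).2).trans (hb w v).2)
    _ = 5 := by
        simp only [Finset.sum_const, Finset.card_univ, nsmul_eq_mul]
        field_simp

theorem sum_completeKernel_mul_mem_Icc (hV : 3 ≤ Fintype.card V) {φ : V → ℝ}
    (hφ : ∀ v, φ v ∈ Icc (0 : ℝ) 1) (u : V) :
    ∑ v, completeKernel V v u * φ v ∈ Icc (0 : ℝ) 1 := by
  classical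
  have hN : (3 : ℝ) ≤ Fintype.card V := by exact_mod_cast hV
  have ha : ∀ v, 0 ≤ completeKernel V u v := fun v => by
    unfold completeKernel
    split_ifs
    · exact div_nonneg zero_le_one (by linarith)
    · exact le_rfl
  simp_rw [completeKernel_comm _ u]
  refine ⟨Finset.sum_nonneg fun v _ => mul_nonneg (ha v) (hφ v).1, ?_⟩
  have h1 := sum_completeKernel_mul (fun _ => (1 : ℝ)) u
  simp only [Finset.sum_const, Finset.card_univ, nsmul_eq_mul, mul_one] at h1
  rw [div_self (by linarith)] at h1
  rw [← h1]
  exact Finset.sum_le_sum fun v _ => mul_le_of_le_one_right (ha v) (hφ v).2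

theorem vmbcRate_le (hα : 0 ≤ α) (hγ : 0 ≤ γ) (hV : 3 ≤ Fintype.card V) (u : V) (X : V → Bool) :
    vmbcRate (completeKernel V) (coopKernel (completeKernel V)) α γ u X ≤ 1 + α + 5 * γ := by
  have ho : ∀ v, occ X v ∈ Icc (0 : ℝ) 1 := fun v => ⟨occ_nonneg X v, occ_le_one X v⟩
  have ho' : ∀ v, 1 - occ X v ∈ Icc (0 : ℝ) 1 := fun v =>
    ⟨by linarith [(ho v).2], by linarith [(ho v).1]⟩
  unfold vmbcRate
  split_ifs
  · have h1 := mul_le_mul_of_nonneg_left (sum_completeKernel_mul_mem_Icc hV ho' u).2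
      (show 0 ≤ 1 + α by linarith)
    have h2 := mul_le_mul_of_nonneg_left (sum_coopKernel_le hV ho' ho u).2 hγ
    linarith
  · have h1 := (sum_completeKernel_mul_mem_Icc hV ho u).2
    have h2 := mul_le_mul_of_nonneg_left (sum_coopKernel_le hV ho ho u).2 hγ
    linarith

/-- The drift of the number of cooperators. The cooperation terms of births and deaths cancel
because the two-step kernel is symmetric in its last two vertices; this is why the limit does not
depend on `γ`. -/
theorem sum_vmbcRate_mul (hV : 3 ≤ Fintype.card V) (X : V → Bool) :
    ∑ u, vmbcRate (completeKernel V) (coopKernel (completeKernel V)) α γ u X * (1 - 2 * occ X u)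
      = -α * ((∑ u, occ X u) * (Fintype.card V - ∑ u, occ X u)) / ((Fintype.card V : ℝ) - 1) := by
  set b := coopKernel (completeKernel V) with hb
  set k := ∑ u, occ X u with hk
  have hbirth : ∑ u, (1 - occ X u) * ∑ v, completeKernel V v u * occ X v
      = k * (Fintype.card V - k) / ((Fintype.card V : ℝ) - 1) := by
    have h : ∀ u, (1 - occ X u) * ∑ v, completeKernel V v u * occ X v
        = (1 - occ X u) * (k / ((Fintype.card V : ℝ) - 1)) := fun u => by
      simp_rw [completeKernel_comm _ u]
      rw [sum_completeKernel_mul, ← hk]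
      by_cases hu : X u <;> simp [occ, hu]
    simp_rw [h, ← Finset.sum_mul, Finset.sum_sub_distrib, ← hk]
    simp
    ring
  have hdeath : ∑ u, occ X u * ∑ v, completeKernel V v u * (1 - occ X v)
      = k * (Fintype.card V - k) / ((Fintype.card V : ℝ) - 1) := by
    rw [← hbirth]
    simp_rw [Finset.mul_sum]
    rw [Finset.sum_comm]
    refine Finset.sum_congr rfl fun u _ => Finset.sum_congr rfl fun v _ => ?_
    rw [completeKernel_comm u v]
    ring
  have hcoop : ∑ u, (1 - occ X u) * ∑ v, occ X v * ∑ w, occ X w * b w (v, u)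
      = ∑ u, occ X u * ∑ v, (1 - occ X v) * ∑ w, occ X w * b w (v, u) := by
    simp_rw [Finset.mul_sum]
    rw [Finset.sum_comm]
    refine Finset.sum_congr rfl fun u _ => Finset.sum_congr rfl fun v _ =>
      Finset.sum_congr rfl fun w _ => ?_
    rw [hb, coopKernel_completeKernel_comm hV w u v]
    ring
  have hterm : ∀ u, vmbcRate (completeKernel V) b α γ u X * (1 - 2 * occ X u)
      = (1 - occ X u) * ∑ v, completeKernel V v u * occ X v
        - (1 + α) * (occ X u * ∑ v, completeKernel V v u * (1 - occ X v))
        + (γ * ((1 - occ X u) * ∑ v, occ X v * ∑ w, occ X w * b w (v, u))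
        - γ * (occ X u * ∑ v, (1 - occ X v) * ∑ w, occ X w * b w (v, u))) := fun u => by
    have hu : X u = true ∧ occ X u = 1 ∨ ¬ X u = true ∧ occ X u = 0 := by
      unfold occ
      by_cases hu : X u = true <;> simp [hu]
    rcases hu with ⟨h1, h2⟩ | ⟨h1, h2⟩
    · rw [vmbcRate, if_pos h1, h2]; ring
    · rw [vmbcRate, if_neg h1, h2]; ring
  simp_rw [hterm, Finset.sum_add_distrib, Finset.sum_sub_distrib, ← Finset.mul_sum]
  rw [hbirth, hdeath, hcoop]
  ring

variable [DecidableEq V]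

theorem spinGenerator_apply (c : V → (V → Bool) → ℝ) (f : (V → Bool) → ℝ) (X : V → Bool) :
    spinGenerator c f X = ∑ u, c u X * (f (flipAt X u) - f X) := rfl

theorem coopFreq_flipAt (X : V → Bool) (u : V) :
    coopFreq (flipAt X u) = coopFreq X + (1 - 2 * occ X u) / Fintype.card V := by
  have h : ∑ v, occ (flipAt X u) v = ∑ v, occ X v + (1 - 2 * occ X u) := by
    rw [← sub_eq_iff_eq_add', ← Finset.sum_sub_distrib, Finset.sum_eq_single u]
    · by_cases hu : X u <;> simp [occ, flipAt, hu]
      norm_num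
    · intro v _ hv
      simp [occ, flipAt, Function.update_of_ne hv]
    · simp
  rw [coopFreq, coopFreq, h]
  ring

/-- The generator of the square distance of the frequency to a point: twice the drift times the
displacement, plus a quadratic variation of order `1 / N`. -/
theorem spinGenerator_sq_sub_le (hα : 0 ≤ α) (hγ : 0 ≤ γ) (hV : 3 ≤ Fintype.card V) (y : ℝ)
    (X : V → Bool) :
    spinGenerator (vmbcRate (completeKernel V) (coopKernel (completeKernel V)) α γ)
        (fun x => (coopFreq x - y) ^ 2) X
      ≤ 2 * (coopFreq X - y) * (-α * (coopFreq X * (1 - coopFreq X)) *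
          (1 + 1 / ((Fintype.card V : ℝ) - 1))) + (1 + α + 5 * γ) / Fintype.card V := by
  have hN : (3 : ℝ) ≤ Fintype.card V := by exact_mod_cast hV
  set N : ℝ := (Fintype.card V : ℝ) with hNdef
  set c := vmbcRate (completeKernel V) (coopKernel (completeKernel V)) α γ with hc
  have hdrift := sum_vmbcRate_mul (α := α) (γ := γ) hV X
  rw [← hc, ← hNdef] at hdrift
  have hsum : ∑ u, occ X u = N * coopFreq X := by
    rw [coopFreq, ← hNdef]
    field_simp
  have hterm : ∀ u, c u X * ((coopFreq (flipAt X u) - y) ^ 2 - (coopFreq X - y) ^ 2)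
      = 2 * (coopFreq X - y) / N * (c u X * (1 - 2 * occ X u)) + c u X / N ^ 2 := fun u => by
    have hsq : (1 - 2 * occ X u) ^ 2 = 1 := by
      by_cases hu : X u <;> simp [occ, hu]
      norm_num
    rw [coopFreq_flipAt, ← hNdef]
    field_simp
    linear_combination c u X * hsq
  rw [spinGenerator_apply]
  simp_rw [hterm, Finset.sum_add_distrib, ← Finset.mul_sum]
  rw [hdrift, hsum]
  refine add_le_add (le_of_eq ?_) ?_
  · have h1 : N - 1 ≠ 0 := by linarith
    field_simp
    ring
  · calc ∑ u, c u X / N ^ 2 ≤ ∑ _u : V, (1 + α + 5 * γ) / N ^ 2 := by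
          gcongr with u
          exact vmbcRate_le hα hγ hV u X
      _ = (1 + α + 5 * γ) / N := by
          rw [Finset.sum_const, Finset.card_univ, nsmul_eq_mul, ← hNdef]
          field_simp

end Generator

/-! ### A maximal inequality for Markov chains on a time grid -/

section Maximal

theorem IsMarkovProcess.history_le {Ω : Type*} [MeasurableSpace Ω] {P : Measure Ω}
    {A : Type*} [Fintype A] [TopologicalSpace A] [MeasurableSpace A]
    {X : Ω → CadlagPath A} {L : (A → ℝ) →L[ℝ] (A → ℝ)} (hX : IsMarkovProcess P X L) (s : ℝ≥0) :
    (⨆ r : Iic s, MeasurableSpace.comap (fun ω => X ω r) inferInstance) ≤ ‹MeasurableSpace Ω› :=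
  iSup_le fun r => (hX.measurable r).comap_le

theorem measurable_history {Ω A : Type*} [TopologicalSpace A] [MeasurableSpace A]
    [DiscreteMeasurableSpace A] {X : Ω → CadlagPath A} (g : A → ℝ) {r s : ℝ≥0} (hr : r ≤ s) :
    Measurable[⨆ r : Iic s, MeasurableSpace.comap (fun ω => X ω r) inferInstance]
      (fun ω => g (X ω r)) :=
  (Measurable.of_discrete (f := g)).comp ((comap_measurable _).mono
    (le_iSup (fun r : Iic s => MeasurableSpace.comap (fun ω => X ω r) inferInstance) ⟨r, hr⟩)
    le_rfl)

variable {Ω : Type*} [MeasurableSpace Ω] {P : Measure Ω} [IsProbabilityMeasure P]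
  {A : Type*} [Fintype A] [TopologicalSpace A] [MeasurableSpace A] [DiscreteMeasurableSpace A]
  {X : Ω → CadlagPath A} {L : (A → ℝ) →L[ℝ] (A → ℝ)}

theorem IsMarkovProcess.integrable_comp (hX : IsMarkovProcess P X L) (g : A → ℝ) (s : ℝ≥0) :
    Integrable (fun ω => g (X ω s)) P :=
  Integrable.of_bound ((Measurable.of_discrete (f := g)).comp (hX.measurable s)).aestronglyMeasurable
    ‖g‖ (ae_of_all _ fun ω => norm_le_pi_norm g (X ω s))

theorem IsMarkovProcess.setIntegral_eq (hX : IsMarkovProcess P X L) (s h : ℝ≥0) (g : A → ℝ)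
    {B : Set Ω} (hB : MeasurableSet[⨆ r : Iic s, MeasurableSpace.comap (fun ω => X ω r)
      inferInstance] B) :
    ∫ ω in B, g (X ω (s + h)) ∂P = ∫ ω in B, NormedSpace.exp ((h : ℝ) • L) g (X ω s) ∂P := by
  rw [← setIntegral_condExp (hX.history_le s) (hX.integrable_comp g (s + h)) hB]
  exact integral_congr_ae (ae_restrict_of_ae (hX.markov s h g))

/-- A maximal inequality of Doob type: the functions `g k` of the chain observed at the times `k h`
grow in mean by at most a factor `c` and a summand `δ` per step, as long as the chain, started in
`a`, has not yet reached the level `ℓ`. Stopping at the first passage over `ℓ` bounds the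
probability of a passage. -/
theorem IsMarkovProcess.maximal_ineq (hX : IsMarkovProcess P X L) (a : A) (h : ℝ≥0)
    {g : ℕ → A → ℝ} (hg : ∀ k x, 0 ≤ g k x) (hg0 : g 0 a = 0) {c δ ℓ : ℝ} (hc : 1 ≤ c)
    (hδ : 0 ≤ δ) (hℓ : 0 < ℓ)
    (hstep : ∀ k x, NormedSpace.exp ((h : ℝ) • L) (g (k + 1)) x ≤ c * g k x + δ) (n : ℕ) :
    ℓ * P.real {ω | X ω 0 = a ∧ ∃ k ≤ n, ℓ ≤ g k (X ω (k * h))}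
      ≤ c ^ n * (n * δ) * P.real {ω | X ω 0 = a} := by
  set B : Set Ω := {ω | X ω 0 = a} with hB
  set S : ℕ → Set Ω := fun k => {ω | X ω 0 = a ∧ ∀ j ≤ k, g j (X ω (j * h)) < ℓ} with hS
  have hSm' : ∀ k : ℕ, MeasurableSet[⨆ r : Iic ((k : ℝ≥0) * h),
      MeasurableSpace.comap (fun ω => X ω r) inferInstance] (S k) := by
    intro k
    have h1 : S k = {ω | X ω 0 = a} ∩ ⋂ j : Fin (k + 1), {ω | g j (X ω ((j : ℕ) * h)) < ℓ} := by
      ext ω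
      simp only [hS, mem_ofPred_eq, mem_inter_iff, mem_iInter]
      exact and_congr_right fun _ => ⟨fun H j => H j (Nat.lt_succ_iff.1 j.2),
        fun H j hj => H ⟨j, Nat.lt_succ_iff.2 hj⟩⟩
    rw [h1]
    refine MeasurableSet.inter ?_ (MeasurableSet.iInter fun j => ?_)
    · classical
      have := measurable_history (X := X) (fun x : A => if x = a then (1 : ℝ) else 0)
        (zero_le (a := (k : ℝ≥0) * h)) (measurableSet_singleton (1 : ℝ))
      convert this using 1
      ext ω
      simp
    · refine measurable_history (X := X) (g j) ?_ measurableSet_Iio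
      gcongr
      exact Nat.lt_succ_iff.1 j.2
  have hSm : ∀ k, MeasurableSet (S k) := fun k => hX.history_le _ _ (hSm' k)
  have hBm : MeasurableSet B := hX.measurable 0 (measurableSet_singleton a)
  have hanti : ∀ k, S (k + 1) ⊆ S k := fun k ω hω => ⟨hω.1, fun j hj => hω.2 j (by omega)⟩
  have hSB : ∀ k, S k ⊆ B := fun k ω hω => hω.1
  have hint : ∀ k (s : ℝ≥0), Integrable (fun ω => g k (X ω s)) P := fun k s =>
    hX.integrable_comp (g k) s
  -- Over one step, the mass `ℓ P(passage)` plus the mean of `g` before passage grows by at most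
  -- the factor `c` and the summand `δ P(X 0 = a)`.
  have hone : ∀ k : ℕ, ℓ * P.real (B \ S (k + 1))
        + ∫ ω in S (k + 1), g (k + 1) (X ω ((k + 1 : ℕ) * h)) ∂P
      ≤ c * (ℓ * P.real (B \ S k) + ∫ ω in S k, g k (X ω (k * h)) ∂P) + δ * P.real B := by
    intro k
    have e1 : ((k + 1 : ℕ) : ℝ≥0) * h = k * h + h := by push_cast; ring
    have e2 : P.real (B \ S (k + 1)) = P.real (B \ S k) + P.real (S k \ S (k + 1)) := by
      rw [← measureReal_union _ ((hSm k).diff (hSm (k + 1))),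
        sdiff_union_sdiff_cancel (hSB k) (hanti k)]
      exact disjoint_left.2 fun ω h1 h2 => h1.2 h2.1
    have e3 : ∫ ω in S k, g (k + 1) (X ω ((k + 1 : ℕ) * h)) ∂P
        ≤ c * ∫ ω in S k, g k (X ω (k * h)) ∂P + δ * P.real B := by
      rw [e1, hX.setIntegral_eq (k * h) h (g (k + 1)) (hSm' k)]
      calc ∫ ω in S k, NormedSpace.exp ((h : ℝ) • L) (g (k + 1)) (X ω (k * h)) ∂P
          ≤ ∫ ω in S k, (c * g k (X ω (k * h)) + δ) ∂P :=
            integral_mono (hX.integrable_comp _ _).integrableOn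
              (((hint k _).const_mul c).add (integrable_const δ)).integrableOn
              fun ω => hstep k _
        _ = c * ∫ ω in S k, g k (X ω (k * h)) ∂P + δ * P.real (S k) := by
            rw [integral_add ((hint k _).const_mul c).integrableOn (integrable_const δ).integrableOn,
              integral_const_mul]
            simp [mul_comm]
        _ ≤ _ := by
            exact add_le_add_right
              (mul_le_mul_of_nonneg_left (measureReal_mono (hSB k)) hδ) _
    have e4 : ∫ ω in S k, g (k + 1) (X ω ((k + 1 : ℕ) * h)) ∂P
        = ∫ ω in S (k + 1), g (k + 1) (X ω ((k + 1 : ℕ) * h)) ∂P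
          + ∫ ω in S k \ S (k + 1), g (k + 1) (X ω ((k + 1 : ℕ) * h)) ∂P := by
      rw [← setIntegral_union disjoint_sdiff_self_right ((hSm k).diff (hSm (k + 1)))
        (hint _ _).integrableOn (hint _ _).integrableOn, union_sdiff_cancel (hanti k)]
    have e5 : ℓ * P.real (S k \ S (k + 1))
        ≤ ∫ ω in S k \ S (k + 1), g (k + 1) (X ω ((k + 1 : ℕ) * h)) ∂P := by
      have : ∫ _ω in S k \ S (k + 1), ℓ ∂P
          ≤ ∫ ω in S k \ S (k + 1), g (k + 1) (X ω ((k + 1 : ℕ) * h)) ∂P := by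
        refine setIntegral_mono_on (integrable_const ℓ).integrableOn (hint _ _).integrableOn
          ((hSm k).diff (hSm (k + 1))) fun ω hω => ?_
        by_contra! hcon
        refine hω.2 ⟨hω.1.1, fun j hj => ?_⟩
        rcases Nat.le_succ_iff.1 hj with hj | rfl
        · exact hω.1.2 j hj
        · exact hcon
      simpa [mul_comm] using this
    have e6 : 0 ≤ (c - 1) * (ℓ * P.real (B \ S k)) :=
      mul_nonneg (by linarith) (mul_nonneg hℓ.le measureReal_nonneg)
    rw [e2]
    linarith
  have hall : ∀ k : ℕ, ℓ * P.real (B \ S k) + ∫ ω in S k, g k (X ω (k * h)) ∂P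
      ≤ c ^ k * (k * δ) * P.real B := by
    intro k
    induction k with
    | zero =>
      have h0 : S 0 = B := by
        refine (hSB 0).antisymm fun ω hω => ⟨hω, fun j hj => ?_⟩
        obtain rfl := Nat.le_zero.1 hj
        have : X ω 0 = a := hω
        simpa [this, hg0] using hℓ
      have h1 : ∫ ω in B, g 0 (X ω ((0 : ℕ) * h)) ∂P = 0 := by
        rw [setIntegral_congr_fun (g := fun _ => (0 : ℝ)) hBm fun ω hω => ?_]
        · simp
        · have : X ω 0 = a := hω
          simp [this, hg0]
      rw [h0, h1]
      simp
    | succ k ih =>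
      have hp : 0 ≤ δ * P.real B := mul_nonneg hδ measureReal_nonneg
      have h1 := mul_le_mul_of_nonneg_left ih (show 0 ≤ c by linarith)
      have h2 : δ * P.real B ≤ c ^ (k + 1) * (δ * P.real B) :=
        le_mul_of_one_le_left hp (one_le_pow₀ hc)
      calc _ ≤ _ := hone k
        _ ≤ c * (c ^ k * (k * δ) * P.real B) + c ^ (k + 1) * (δ * P.real B) := by linarith
        _ = _ := by push_cast; ring
  have hset : {ω | X ω 0 = a ∧ ∃ k ≤ n, ℓ ≤ g k (X ω (k * h))} = B \ S n := by
    ext ω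
    simp only [hS, hB, mem_ofPred_eq, Set.mem_sdiff, not_and, not_forall, not_lt, exists_prop]
    exact and_congr_right fun ha => ⟨fun H _ => H, fun H => H ha⟩
  rw [hset]
  have hpos : 0 ≤ ∫ ω in S n, g n (X ω (n * h)) ∂P := integral_nonneg fun ω => hg n _
  linarith [hall n]

end Maximal

/-- The semigroup `exp (h L)` agrees with `1 + h L` to first order, uniformly on bounded sets. -/
theorem exists_exp_smul_le {A : Type*} [Fintype A] (L : (A → ℝ) →L[ℝ] (A → ℝ)) {η : ℝ}
    (hη : 0 < η) : ∃ h₀ > 0, ∀ h : ℝ, 0 ≤ h → h < h₀ → ∀ g : A → ℝ, ‖g‖ ≤ 1 → ∀ x,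
      NormedSpace.exp (h • L) g x ≤ g x + h * L g x + η * h := by
  have hd := hasDerivAt_exp_smul_const L (0 : ℝ)
  rw [hasDerivAt_iff_isLittleO] at hd
  have hev := hd.bound hη
  obtain ⟨h₀, hh₀, hball⟩ := Metric.eventually_nhds_iff.1 hev
  refine ⟨h₀, hh₀, fun h h0 hlt g hgn x => ?_⟩
  have h1 := hball (y := h) (by rwa [Real.dist_eq, sub_zero, abs_of_nonneg h0])
  simp only [zero_smul, NormedSpace.exp_zero, sub_zero, one_mul, Real.norm_eq_abs,
    abs_of_nonneg h0] at h1
  have h2 := (ContinuousLinearMap.le_opNorm (NormedSpace.exp (h • L) - 1 - h • L) g).trans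
    (mul_le_mul h1 hgn (norm_nonneg _) (by positivity))
  have h3 := (norm_le_pi_norm _ x).trans h2
  have h4 : ((NormedSpace.exp (h • L) - 1 - h • L) g) x
      = NormedSpace.exp (h • L) g x - g x - h * L g x := rfl
  rw [h4, Real.norm_eq_abs, mul_one] at h3
  linarith [le_abs_self (NormedSpace.exp (h • L) g x - g x - h * L g x)]

/-! ### The frequency stays close to the logistic flow -/

section Deviation

/-- The event that the frequency deviates from the logistic flow by `ε` at one of the times
`k / 2 ^ m ≤ T`. -/
def gridDeviation {Ω V : Type*} [Fintype V] (α : ℝ) (X : Ω → CadlagPath (V → Bool))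
    (ε : ℝ) (T m : ℕ) : Set Ω :=
  {ω | ∃ k ≤ T * 2 ^ m, ε ^ 2 ≤ (coopFreq (X ω (k * (1 / 2 ^ m)))
    - logisticFlow α (coopFreq (X ω 0)) (k * (1 / 2 ^ m))) ^ 2}

theorem monotone_gridDeviation {Ω V : Type*} [Fintype V] (α : ℝ)
    (X : Ω → CadlagPath (V → Bool)) (ε : ℝ) (T : ℕ) :
    Monotone (gridDeviation α X ε T) := by
  refine monotone_nat_of_le_succ fun m => ?_
  rintro ω ⟨k, hk, h⟩
  refine ⟨2 * k, by rw [pow_succ, ← mul_assoc]; omega, ?_⟩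
  have e1 : ((2 * k : ℕ) : ℝ≥0) * (1 / 2 ^ (m + 1)) = k * (1 / 2 ^ m) := by
    push_cast; rw [pow_succ]; field_simp
  have e2 : ((2 * k : ℕ) : ℝ) * (1 / 2 ^ (m + 1)) = k * (1 / 2 ^ m) := by
    push_cast; rw [pow_succ]; field_simp
  rwa [e1, e2]

variable {V : Type*} [Fintype V] [DecidableEq V] {α γ : ℝ}

/-- One step of the semigroup, applied to the square distance to the logistic flow: the Lipschitz
constant of the logistic vector field gives the factor, and the quadratic variation and the
discrepancy between the drift on `N` vertices and the vector field give the summand of order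
`h / N`. -/
theorem exists_exp_sq_sub_logisticFlow_le (hα : 0 ≤ α) (hγ : 0 ≤ γ) (hV : 3 ≤ Fintype.card V) :
    ∃ h₀ > 0, ∀ h : ℝ, 0 ≤ h → h < h₀ → ∀ z ∈ Icc (0 : ℝ) 1, ∀ (t : ℝ) (x : V → Bool),
      NormedSpace.exp
          (h • spinGenerator (vmbcRate (completeKernel V) (coopKernel (completeKernel V)) α γ))
          (fun x => (coopFreq x - logisticFlow α z (t + h)) ^ 2) x
        ≤ (1 + 2 * α * h) * (coopFreq x - logisticFlow α z t) ^ 2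
          + h * ((2 + 5 * α + 5 * γ) / Fintype.card V) := by
  have hN : (3 : ℝ) ≤ Fintype.card V := by exact_mod_cast hV
  set N : ℝ := (Fintype.card V : ℝ) with hNdef
  set L := spinGenerator (vmbcRate (completeKernel V) (coopKernel (completeKernel V)) α γ) with hL
  obtain ⟨h₁, hh₁, hexp⟩ := exists_exp_smul_le L (η := 1 / (2 * N)) (by positivity)
  -- Below this bound the second order terms are at most `h / (2 N)`.
  refine ⟨min h₁ (1 / (14 * N * (α ^ 2 + 1))), lt_min hh₁ (by positivity), ?_⟩
  intro h h0 hlt z hz t x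
  have hsmall : 7 * α ^ 2 * h ≤ 1 / (2 * N) := by
    have h1 := (hlt.trans_le (min_le_right _ _)).le
    rw [le_div_iff₀ (by positivity)] at h1 ⊢
    nlinarith
  set y := logisticFlow α z t with hy
  set y' := logisticFlow α z (t + h) with hy'
  have hy01 : y ∈ Icc (0 : ℝ) 1 := logisticFlow_mem_Icc hz
  have hy'01 : y' ∈ Icc (0 : ℝ) 1 := logisticFlow_mem_Icc hz
  have hnorm : ‖fun x : V → Bool => (coopFreq x - y') ^ 2‖ ≤ 1 := by
    refine (pi_norm_le_iff_of_nonneg zero_le_one).2 fun x => ?_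
    obtain ⟨h1, h2⟩ := coopFreq_mem_Icc x
    rw [Real.norm_eq_abs, abs_of_nonneg (sq_nonneg _), sq_le_one_iff_abs_le_one, abs_le]
    constructor <;> linarith [hy'01.1, hy'01.2]
  have hstep := hexp h h0 (hlt.trans_le (min_le_left _ _)) _ hnorm x
  have hgen := spinGenerator_sq_sub_le hα hγ hV y' x
  rw [← hL, ← hNdef] at hgen
  have he1 : |y' - y| ≤ α * h := abs_logisticFlow_add_sub_le hα hz h0
  have he2 : |y' - y - h * (-α * y * (1 - y))| ≤ α ^ 2 * h ^ 2 := abs_logisticFlow_euler_le hα hz h0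
  set f := coopFreq x with hf
  obtain ⟨hf0, hf1⟩ := coopFreq_mem_Icc x
  rw [← hf] at hf0 hf1
  have hN1 : 0 < 1 / (N - 1) := one_div_pos.2 (by linarith)
  have hN2 : 1 / (N - 1) ≤ 2 / N := by
    rw [div_le_div_iff₀ (by linarith) (by linarith)]; linarith
  have hN3 : 1 / (N - 1) ≤ 1 := by rw [div_le_one (by linarith)]; linarith
  have hff0 : 0 ≤ f * (1 - f) := mul_nonneg hf0 (by linarith)
  have hff1 : f * (1 - f) ≤ 1 := by nlinarith
  set β := -α * (f * (1 - f)) * (1 + 1 / (N - 1)) with hβ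
  have hD : |f - y| ≤ 1 := abs_le.2 ⟨by linarith [hy01.2], by linarith [hy01.1]⟩
  have hβ2 : |β| ≤ 2 * α := by
    rw [hβ, abs_mul, abs_mul, abs_neg, abs_of_nonneg hα, abs_of_nonneg hff0,
      abs_of_pos (by linarith)]
    calc α * (f * (1 - f)) * (1 + 1 / (N - 1)) ≤ α * 1 * 2 := by gcongr; linarith
      _ = 2 * α := by ring
  -- The drift differs from the vector field by the Lipschitz term and a term of order `1 / N`.
  have hmain : (f - y) * (β - -α * y * (1 - y)) ≤ α * (f - y) ^ 2 + α * (2 / N) := by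
    have e1 : (f - y) * (β - -α * y * (1 - y)) = α * ((f - y) ^ 2 * (f + y - 1))
        + α * (1 / (N - 1)) * (f * (1 - f) * -(f - y)) := by rw [hβ]; ring
    have e2 : (f - y) ^ 2 * (f + y - 1) ≤ (f - y) ^ 2 :=
      mul_le_of_le_one_right (sq_nonneg _) (by linarith [hy01.2])
    have e3 : f * (1 - f) * -(f - y) ≤ 1 := by nlinarith [abs_le.1 hD]
    have e4 : α * (1 / (N - 1)) * (f * (1 - f) * -(f - y)) ≤ α * (1 / (N - 1)) :=
      mul_le_of_le_one_right (by positivity) e3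
    have e5 := mul_le_mul_of_nonneg_left hN2 hα
    have e6 := mul_le_mul_of_nonneg_left e2 hα
    linarith
  have hr1 : -(f - y) * (y' - y - h * (-α * y * (1 - y))) ≤ α ^ 2 * h ^ 2 := by
    refine (le_abs_self _).trans ?_
    rw [abs_mul, abs_neg]
    exact (mul_le_of_le_one_left (abs_nonneg _) hD).trans he2
  have hr2 : (y' - y) ^ 2 ≤ α ^ 2 * h ^ 2 := by
    rw [← sq_abs, ← mul_pow]
    exact pow_le_pow_left₀ (abs_nonneg _) he1 2
  have hr3 : -((y' - y) * β) ≤ 2 * α ^ 2 * h := by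
    refine (neg_le_abs _).trans ?_
    rw [abs_mul]
    calc |y' - y| * |β| ≤ α * h * (2 * α) := by gcongr
      _ = 2 * α ^ 2 * h := by ring
  have hexpand : (f - y') ^ 2 + h * (2 * (f - y') * β)
      = (f - y) ^ 2 + 2 * h * ((f - y) * (β - -α * y * (1 - y)))
        + 2 * (-(f - y) * (y' - y - h * (-α * y * (1 - y)))) + (y' - y) ^ 2
        + 2 * h * (-((y' - y) * β)) := by ring
  have hm := mul_le_mul_of_nonneg_left hmain (show 0 ≤ 2 * h by linarith)
  have hm3 := mul_le_mul_of_nonneg_left hr3 (show 0 ≤ 2 * h by linarith)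
  have hm4 := mul_le_mul_of_nonneg_left hgen h0
  have hm5 := mul_le_mul_of_nonneg_left hsmall h0
  calc _ ≤ _ := hstep
    _ ≤ (f - y') ^ 2 + h * (2 * (f - y') * β) + h * ((1 + α + 5 * γ) / N) + 1 / (2 * N) * h := by
        linarith
    _ ≤ (f - y) ^ 2 + 2 * h * (α * (f - y) ^ 2 + α * (2 / N)) + h * (1 / (2 * N))
        + h * ((1 + α + 5 * γ) / N) + 1 / (2 * N) * h := by
        rw [hexpand]
        linarith
    _ = _ := by
        field_simp
        ring

variable {Ω : Type*} [MeasurableSpace Ω] {P : Measure Ω} [IsProbabilityMeasure P]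
  {X : Ω → CadlagPath (V → Bool)}

theorem measureReal_gridDeviation_le (hα : 0 ≤ α) (hγ : 0 ≤ γ) (hV : 3 ≤ Fintype.card V)
    (hX : IsCVMBC P (completeKernel V) α γ X) {ε : ℝ} (hε : 0 < ε) (T : ℕ) :
    ∀ᶠ m in atTop, P.real (gridDeviation α X ε T m)
      ≤ Real.exp (2 * α * T) * T * (2 + 5 * α + 5 * γ) / ε ^ 2 / Fintype.card V := by
  obtain ⟨h₀, hh₀, hstep⟩ := exists_exp_sq_sub_logisticFlow_le hα hγ hV
  have hlim : Tendsto (fun m : ℕ => (1 / 2 : ℝ) ^ m) atTop (𝓝 0) :=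
    tendsto_pow_atTop_nhds_zero_of_lt_one (by norm_num) (by norm_num)
  filter_upwards [hlim.eventually_lt_const hh₀] with m hm
  rw [one_div_pow] at hm
  set K := (2 + 5 * α + 5 * γ) / (Fintype.card V : ℝ) with hK
  have hK0 : 0 ≤ K := by positivity
  set h : ℝ≥0 := 1 / 2 ^ m with hh
  have hcoe : (h : ℝ) = 1 / 2 ^ m := by rw [hh]; push_cast; rfl
  rw [← hcoe] at hm
  have hTh : ((T * 2 ^ m : ℕ) : ℝ) * h = T := by
    rw [hcoe]; push_cast; field_simp
  have hstart : ∀ a : V → Bool,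
      P.real {ω | X ω 0 = a ∧ ∃ k ≤ T * 2 ^ m, ε ^ 2 ≤ (coopFreq (X ω (k * h))
        - logisticFlow α (coopFreq a) (k * h)) ^ 2}
      ≤ Real.exp (2 * α * T) * (T * K) / ε ^ 2 * P.real {ω | X ω 0 = a} := by
    intro a
    have := IsMarkovProcess.maximal_ineq hX a h
      (g := fun k x => (coopFreq x - logisticFlow α (coopFreq a) (k * h)) ^ 2)
      (fun k x => sq_nonneg _) (by simp [logisticFlow_zero]) (c := 1 + 2 * α * h) (δ := h * K)
      (ℓ := ε ^ 2) (by have := h.2; simp only [le_add_iff_nonneg_right]; positivity) (by positivity)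
      (by positivity)
      (fun k x => by
        have := hstep h h.2 hm (coopFreq a) (coopFreq_mem_Icc a) (k * h) x
        have e : ((k + 1 : ℕ) : ℝ) * h = k * h + h := by push_cast; ring
        rw [e]
        exact this) (T * 2 ^ m)
    rw [div_mul_eq_mul_div, le_div_iff₀ (by positivity), mul_comm]
    refine this.trans (mul_le_mul_of_nonneg_right ?_ measureReal_nonneg)
    rw [← mul_assoc (_ : ℝ) (h : ℝ) K, hTh]
    refine mul_le_mul_of_nonneg_right ?_ (by positivity)
    calc (1 + 2 * α * (h : ℝ)) ^ (T * 2 ^ m) ≤ Real.exp (2 * α * h) ^ (T * 2 ^ m) := by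
          gcongr
          linarith [Real.add_one_le_exp (2 * α * (h : ℝ))]
      _ = Real.exp (2 * α * T) := by
          rw [← Real.exp_nat_mul, ← hTh]
          congr 1; ring
  have hunion : gridDeviation α X ε T m ⊆ ⋃ a : V → Bool,
      {ω | X ω 0 = a ∧ ∃ k ≤ T * 2 ^ m, ε ^ 2 ≤ (coopFreq (X ω (k * h))
        - logisticFlow α (coopFreq a) (k * h)) ^ 2} := by
    intro ω hω
    refine mem_iUnion.2 ⟨X ω 0, rfl, ?_⟩
    rw [hcoe]
    exact hω
  have htotal : ∑ a : V → Bool, P.real {ω | X ω 0 = a} = 1 := by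
    have h1 := sum_measureReal_preimage_singleton (μ := P) (f := fun ω => X ω 0) Finset.univ
      (fun a _ => hX.measurable 0 (measurableSet_singleton a))
    simp only [Finset.coe_univ, preimage_univ, probReal_univ] at h1
    exact h1
  calc P.real (gridDeviation α X ε T m)
      ≤ ∑ a : V → Bool, P.real {ω | X ω 0 = a ∧ ∃ k ≤ T * 2 ^ m, ε ^ 2 ≤ (coopFreq (X ω (k * h))
        - logisticFlow α (coopFreq a) (k * h)) ^ 2} :=
        (measureReal_mono hunion).trans (measureReal_iUnion_fintype_le _)
    _ ≤ ∑ a : V → Bool, Real.exp (2 * α * T) * (T * K) / ε ^ 2 * P.real {ω | X ω 0 = a} :=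
        Finset.sum_le_sum fun a _ => hstart a
    _ = _ := by
        rw [← Finset.mul_sum, htotal, hK]
        field_simp

/-- The event that the frequency deviates from the logistic flow by more than `ε` before time
`T` has probability of order `1 / N`: by right continuity a deviation is seen on some dyadic
grid. -/
theorem measure_deviation_le (hα : 0 ≤ α) (hγ : 0 ≤ γ) (hV : 3 ≤ Fintype.card V)
    (hX : IsCVMBC P (completeKernel V) α γ X) {ε : ℝ} (hε : 0 < ε) (T : ℕ) :
    P {ω | ∃ t : ℝ≥0, t < T ∧
        ε < |coopFreq (X ω t) - logisticFlow α (coopFreq (X ω 0)) t|}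
      ≤ ENNReal.ofReal
        (Real.exp (2 * α * T) * T * (2 + 5 * α + 5 * γ) / ε ^ 2 / Fintype.card V) := by
  have hsub : {ω | ∃ t : ℝ≥0, t < T ∧
      ε < |coopFreq (X ω t) - logisticFlow α (coopFreq (X ω 0)) t|}
      ⊆ ⋃ m, gridDeviation α X ε T m := by
    rintro ω ⟨t, htT, ht⟩
    set s : ℕ → ℝ≥0 := fun m => ⌈t * 2 ^ m⌉₊ * (1 / 2 ^ m) with hs
    have hts : ∀ m, t ≤ s m := fun m => by
      rw [hs]
      simp only [mul_one_div]
      rw [le_div_iff₀ (by positivity)]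
      exact Nat.le_ceil _
    have hst : ∀ m, s m ≤ t + (1 / 2) ^ m := fun m => by
      rw [hs]
      simp only [mul_one_div, one_div_pow]
      rw [div_le_iff₀ (by positivity), add_mul, one_div_mul_cancel (by positivity)]
      exact (Nat.ceil_lt_add_one zero_le).le
    have hlim : Tendsto (fun m => t + (1 / 2 : ℝ≥0) ^ m) atTop (𝓝 t) := by
      have : Tendsto (fun m : ℕ => (1 / 2 : ℝ≥0) ^ m) atTop (𝓝 0) :=
        NNReal.tendsto_pow_atTop_nhds_zero_of_lt_one (by
          rw [← NNReal.coe_lt_coe]; norm_num)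
      simpa using this.const_add t
    have hst' : Tendsto s atTop (𝓝[≥] t) := tendsto_nhdsWithin_iff.2
      ⟨tendsto_of_tendsto_of_tendsto_of_le_of_le tendsto_const_nhds hlim hts hst,
        Eventually.of_forall hts⟩
    have hright : Tendsto (fun r : ℝ≥0 =>
        |coopFreq (X ω r) - logisticFlow α (coopFreq (X ω 0)) r|) (𝓝[≥] t)
        (𝓝 |coopFreq (X ω t) - logisticFlow α (coopFreq (X ω 0)) t|) := by
      refine (((freqPath (X ω)).right_cont t).sub ?_).abs
      exact (((continuous_logisticFlow (coopFreq_mem_Icc _)).comp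
        NNReal.continuous_coe).tendsto t).mono_left nhdsWithin_le_nhds
    obtain ⟨m, hm⟩ := ((hright.comp hst').eventually_const_lt ht).exists
    refine mem_iUnion.2 ⟨m, ⌈t * 2 ^ m⌉₊, ?_, ?_⟩
    · rw [Nat.ceil_le]
      push_cast
      gcongr
    · rw [← sq_abs (_ - _)]
      refine pow_le_pow_left₀ hε.le ?_ 2
      simp only [Function.comp_apply, hs] at hm
      push_cast at hm
      exact hm.le
  refine (measure_mono hsub).trans ?_
  refine le_of_tendsto (tendsto_measure_iUnion_atTop (monotone_gridDeviation α X ε T)) ?_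
  filter_upwards [measureReal_gridDeviation_le hα hγ hV hX hε T] with m hm
  rw [Function.comp_apply, ← ofReal_measureReal]
  exact ENNReal.ofReal_le_ofReal hm

end Deviation

/-! ### The limit -/

theorem proposition2p5
    (α γ : ℝ) (hα : 0 ≤ α) (hγ : 0 ≤ γ)
    {V : ℕ → Type*} [∀ N, Fintype (V N)] [∀ N, DecidableEq (V N)]
    (hV : ∀ N, Fintype.card (V N) = N)
    {Ω : ℕ → Type*} [∀ N, MeasurableSpace (Ω N)]
    (P : ∀ N, Measure (Ω N)) [∀ N, IsProbabilityMeasure (P N)]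
    (X : ∀ N, Ω N → CadlagPath (V N → Bool))
    (hX : ∀ N, IsCVMBC (P N) (completeKernel (V N)) α γ (X N))
    {Ω' : Type*} [MeasurableSpace Ω'] (P' : Measure Ω') [IsProbabilityMeasure P']
    (s₀ : Ω' → ℝ)
    (h₀ : TendstoInDistribution (fun N ω => freqPath (X N ω) 0) atTop s₀ P P') :
    (∃ S : Ω' → CadlagPath ℝ, ∀ᵐ ω ∂P', IsLogisticSolution α (s₀ ω) (S ω)) ∧
    ∀ S : Ω' → CadlagPath ℝ, (∀ᵐ ω ∂P', IsLogisticSolution α (s₀ ω) (S ω)) →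
      TendstoInDistribution (fun N ω => freqPath (X N ω)) atTop S P P' := by
  -- The limit law is carried by the closed set `[0, 1]`, which carries all the approximations.
  have hs₀ : ∀ᵐ ω ∂P', s₀ ω ∈ Icc (0 : ℝ) 1 := by
    have hlimsup := ProbabilityMeasure.limsup_measure_closed_le_of_tendsto h₀.tendsto
      (isClosed_Icc (a := (0 : ℝ)) (b := 1))
    have hone : ∀ N, (P N).map (fun ω => freqPath (X N ω) 0) (Icc 0 1) = 1 := fun N => by
      rw [Measure.map_apply_of_aemeasurable (h₀.forall_aemeasurable N) measurableSet_Icc]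
      have : (fun ω => freqPath (X N ω) 0) ⁻¹' Icc 0 1 = univ :=
        eq_univ_of_forall fun ω => coopFreq_mem_Icc (X N ω 0)
      rw [this, measure_univ]
    simp only [ProbabilityMeasure.coe_mk, hone, limsup_const] at hlimsup
    rw [Measure.map_apply_of_aemeasurable h₀.aemeasurable_limit measurableSet_Icc] at hlimsup
    have hnull : NullMeasurableSet {ω | s₀ ω ∈ Icc (0 : ℝ) 1} P' :=
      h₀.aemeasurable_limit.nullMeasurable measurableSet_Icc
    exact (prob_compl_eq_zero_iff₀ hnull).2 (le_antisymm prob_le_one hlimsup)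
  refine ⟨⟨fun ω => logisticPath α (s₀ ω), hs₀.mono fun ω hω =>
    isLogisticSolution_logisticPath hω⟩, fun S hS => ?_⟩
  have hSeq : (fun ω => logisticPath α (s₀ ω)) =ᵐ[P'] S := by
    filter_upwards [hs₀, hS] with ω hω hSω
    have : (logisticPath α (s₀ ω)).toFun = (S ω).toFun := funext fun t => by
      rw [hSω.eq_logisticFlow hα hω t, logisticPath_apply hω]
    cases h : S ω
    cases h' : logisticPath α (s₀ ω)
    simp_all
  have hflow : TendstoInDistribution (fun N ω => logisticPath α (freqPath (X N ω) 0)) atTop S P P' :=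
    (h₀.continuous_comp (continuous_logisticPath hα)).congr (fun N => EventuallyEq.rfl) hSeq
  refine hflow.of_forall_uniformity (fun N => ?_) fun U hU => ?_
  · exact (CadlagPath.measurable_of_eval fun t =>
      (Measurable.of_discrete (f := coopFreq)).comp ((hX N).measurable t)).aemeasurable
  · obtain ⟨⟨T, ε⟩, hε, hsub⟩ := CadlagPath.hasBasis_uniformity.mem_iff.1 hU
    obtain ⟨M, hM⟩ := exists_nat_gt T
    have hlim : Tendsto (fun N : ℕ => ENNReal.ofReal
        (Real.exp (2 * α * M) * M * (2 + 5 * α + 5 * γ) / ε ^ 2 / N)) atTop (𝓝 0) := by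
      rw [← ENNReal.ofReal_zero]
      exact ENNReal.tendsto_ofReal (tendsto_const_div_atTop_nhds_zero_nat _)
    refine tendsto_of_tendsto_of_tendsto_of_le_of_le' tendsto_const_nhds hlim
      (Eventually.of_forall fun N => zero_le) ?_
    filter_upwards [eventually_ge_atTop 3] with N hN
    have hdev := measure_deviation_le hα hγ ((hV N).symm ▸ hN) (hX N) hε M
    rw [hV N] at hdev
    refine (measure_mono fun ω hω => ?_).trans hdev
    by_contra! hcon
    refine hω (hsub (CadlagPath.mem_entourage_of_dist_le hε.le fun t ht => ?_))
    have hmem : freqPath (X N ω) 0 ∈ Icc (0 : ℝ) 1 := coopFreq_mem_Icc (X N ω 0)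
    rw [logisticPath_apply hmem, dist_comm]
    by_contra! h
    exact hcon ⟨t, ht.trans_lt hM, h⟩
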